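/- In Orthogonal Buttons and Scissors the input is an $n\times m$ matrix $B$ of non-negative integers and an integer $k\ge 0$. An entry $B[i,j]=0$ means that cell $(i,j)$ is empty, and an entry $B[i,j]=c>0$ means that it contains a button of colour $c$. A cut is a nonempty set of consecutive cells of one row (a horizontal cut) or of one column (a vertical cut) whose two end cells contain buttons and in which all buttons have the same colour; applying it deletes all the buttons in its cells. The cuts are applied one after the other, each being a cut of the grid that the preceding ones leave. The question is whether some sequence of at most $k$ cuts removes all the buttons. Time is measured on a unit-cost random access machine whose words are natural numbers (each colour is one word) and whose operations are addition, truncated subtraction, comparison, and indirect memory access. Then the following hold. 1. Orthogonal Buttons and Scissors can be decided in time $2^{O(k^2\log k)}(n+m)^{O(1)}$: there are one program and one constant $C$ such that on every instance $(B,k)$ the program halts with the right answer after at most $C\cdot 2^{C k^2\log_2 k}\,(n+m+1)^{C}$ steps (where $k^2\log_2 k$ is read as $0$ for $k=0$). 2. In time polynomial in $n+m$, every instance can be reduced to one with $2^{O(k\log k)}$ buttons: there are one program and one constant $C$ such that on every instance $(B,k)$ the program halts after at most $C(n+m+1)^{C}$ steps and outputs an $n'\times m'$ matrix $B'$ with $n'\le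 n$, $m'\le m$ and at most $C\cdot 2^{C k\log_2 k}$ buttons (where $k\log_2 k$ is read as $0$ for $k=0$), such that $(B',k)$ is a yes-instance if and only if $(B,k)$ is a yes-instance. -/

import Mathlib

namespace ButtonsScissors

/-! ### The puzzle

A grid is a matrix of natural numbers: the entry `0` is an empty cell, and an entry `c > 0` is a
button of colour `c`. -/

/-- A horizontal or vertical segment of cells of an `n × m` grid, given by its two ends. -/
inductive Cut (n m : ℕ) where
  | horizontal (i : Fin n) (j₁ j₂ : Fin m)
  | vertical (i₁ i₂ : Fin n) (j : Fin m)

/-- The cell at which the segment starts. -/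
def Cut.first {n m : ℕ} : Cut n m → Fin n × Fin m
  | .horizontal i j₁ _ => (i, j₁)
  | .vertical i₁ _ j => (i₁, j)

/-- The cell at which the segment ends. -/
def Cut.last {n m : ℕ} : Cut n m → Fin n × Fin m
  | .horizontal i _ j₂ => (i, j₂)
  | .vertical _ i₂ j => (i₂, j)

/-- The cells of the segment (none if the ends are in the wrong order). -/
def Cut.cells {n m : ℕ} : Cut n m → Finset (Fin n × Fin m)
  | .horizontal i j₁ j₂ => {i} ×ˢ Finset.Icc j₁ j₂
  | .vertical i₁ i₂ j => Finset.Icc i₁ i₂ ×ˢ {j}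

/-- The segment `C` is a cut of the grid `B`: it is a nonempty sequence of consecutive cells, its
two ends contain buttons, and all the buttons in its cells have the same colour. -/
def Cut.IsValid {n m : ℕ} (C : Cut n m) (B : Matrix (Fin n) (Fin m) ℕ) : Prop :=
  C.first ≤ C.last ∧
  B C.first.1 C.first.2 ≠ 0 ∧ B C.last.1 C.last.2 ≠ 0 ∧
  ∀ p ∈ C.cells, ∀ q ∈ C.cells, B p.1 p.2 ≠ 0 → B q.1 q.2 ≠ 0 → B p.1 p.2 = B q.1 q.2

/-- The application of a cut deletes all the buttons in its cells. -/
def Cut.apply {n m : ℕ} (C : Cut n m) (B : Matrix (Fin n) (Fin m) ℕ) :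
    Matrix (Fin n) (Fin m) ℕ :=
  fun i j => if (i, j) ∈ C.cells then 0 else B i j

/-- The sequence of cuts can be applied to `B`, one after the other, each being a cut of the grid
that the preceding ones leave, and after the last one no button is left. -/
def Clears {n m : ℕ} : List (Cut n m) → Matrix (Fin n) (Fin m) ℕ → Prop
  | [], B => B = 0
  | C :: S, B => C.IsValid B ∧ Clears S (C.apply B)

/-- `(B, k)` is a yes-instance of Orthogonal Buttons and Scissors. -/
def Solvable {n m : ℕ} (B : Matrix (Fin n) (Fin m) ℕ) (k : ℕ) : Prop :=
  ∃ S : List (Cut n m), S.length ≤ k ∧ Clears S B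

/-- The number of buttons of the grid `B`. -/
def numButtons {n m : ℕ} (B : Matrix (Fin n) (Fin m) ℕ) : ℕ :=
  (Finset.univ.filter fun p : Fin n × Fin m => B p.1 p.2 ≠ 0).card

/-! ### The machine model

A random access machine with unit cost, programmed with structured control flow. Its words are
natural numbers, and its memory consists of scalar registers and of arrays; since a program is a
finite text with fixed register and array names, it can use only finitely many of either. The only
operations on words are addition, truncated subtraction and comparison. Every operation, memory
access, test and assignment costs one unit of time. -/

/-- The contents of the memory: `var x` is the content of register `x`, and `arr a i` the content
of cell `i` of array `a`. -/
structure State where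
  var : ℕ → ℕ
  arr : ℕ → ℕ → ℕ

/-- Expressions: constants, registers, array cells (with a computed index), sum, truncated
difference, and the tests `=` and `<` (with value `1` if they hold and `0` if not). -/
inductive Expr where
  | lit (c : ℕ)
  | var (x : ℕ)
  | get (a : ℕ) (e : Expr)
  | add (e₁ e₂ : Expr)
  | sub (e₁ e₂ : Expr)
  | isEq (e₁ e₂ : Expr)
  | isLt (e₁ e₂ : Expr)

/-- The value of an expression. -/
def Expr.eval (σ : State) : Expr → ℕ
  | .lit c => c
  | .var x => σ.var x
  | .get a e => σ.arr a (e.eval σ)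
  | .add e₁ e₂ => e₁.eval σ + e₂.eval σ
  | .sub e₁ e₂ => e₁.eval σ - e₂.eval σ
  | .isEq e₁ e₂ => if e₁.eval σ = e₂.eval σ then 1 else 0
  | .isLt e₁ e₂ => if e₁.eval σ < e₂.eval σ then 1 else 0

/-- The time for the evaluation of an expression: the number of its nodes. -/
def Expr.cost : Expr → ℕ
  | .lit _ => 1
  | .var _ => 1
  | .get _ e => e.cost + 1
  | .add e₁ e₂ => e₁.cost + e₂.cost + 1
  | .sub e₁ e₂ => e₁.cost + e₂.cost + 1
  | .isEq e₁ e₂ => e₁.cost + e₂.cost + 1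
  | .isLt e₁ e₂ => e₁.cost + e₂.cost + 1

/-- Programs. -/
inductive Program where
  | skip
  | assign (x : ℕ) (e : Expr)
  | store (a : ℕ) (idx e : Expr)
  | seq (P Q : Program)
  | cond (e : Expr) (P Q : Program)
  | loop (e : Expr) (P : Program)

/-- The memory after the assignment of `v` to register `x`. -/
def State.setVar (σ : State) (x v : ℕ) : State :=
  { σ with var := Function.update σ.var x v }

/-- The memory after the assignment of `v` to cell `i` of array `a`. -/
def State.setArr (σ : State) (a i v : ℕ) : State :=
  { σ with arr := Function.update σ.arr a (Function.update (σ.arr a) i v) }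

/-- `Exec P σ t τ`: the program `P`, started in the memory `σ`, halts after exactly `t` units of
time in the memory `τ`. Here `cond e P Q` runs `P` if `e` is nonzero and `Q` otherwise, and
`loop e P` runs `P` as long as `e` is nonzero. -/
inductive Exec : Program → State → ℕ → State → Prop
  | skip (σ : State) : Exec .skip σ 1 σ
  | assign (x : ℕ) (e : Expr) (σ : State) :
      Exec (.assign x e) σ (e.cost + 1) (σ.setVar x (e.eval σ))
  | store (a : ℕ) (idx e : Expr) (σ : State) :
      Exec (.store a idx e) σ (idx.cost + e.cost + 1) (σ.setArr a (idx.eval σ) (e.eval σ))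
  | seq {P Q : Program} {σ τ ρ : State} {s t : ℕ} :
      Exec P σ s τ → Exec Q τ t ρ → Exec (.seq P Q) σ (s + t) ρ
  | cond_true {e : Expr} {P Q : Program} {σ τ : State} {t : ℕ} :
      e.eval σ ≠ 0 → Exec P σ t τ → Exec (.cond e P Q) σ (e.cost + 1 + t) τ
  | cond_false {e : Expr} {P Q : Program} {σ τ : State} {t : ℕ} :
      e.eval σ = 0 → Exec Q σ t τ → Exec (.cond e P Q) σ (e.cost + 1 + t) τ
  | loop_true {e : Expr} {P : Program} {σ τ ρ : State} {s t : ℕ} :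
      e.eval σ ≠ 0 → Exec P σ s τ → Exec (.loop e P) τ t ρ →
        Exec (.loop e P) σ (e.cost + 1 + s + t) ρ
  | loop_false {e : Expr} {P : Program} {σ : State} :
      e.eval σ = 0 → Exec (.loop e P) σ (e.cost + 1) σ

/-- The machine is deterministic: running time and final memory are unique. -/
theorem Exec.unique {P : Program} {σ τ τ' : State} {t t' : ℕ}
    (h : Exec P σ t τ) (h' : Exec P σ t' τ') : t = t' ∧ τ = τ' := by
  induction h generalizing t' τ' with
  | skip σ => cases h'; exact ⟨rfl, rfl⟩
  | assign x e σ => cases h'; exact ⟨rfl, rfl⟩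
  | store a idx e σ => cases h'; exact ⟨rfl, rfl⟩
  | seq _ _ ih₁ ih₂ =>
    cases h' with
    | seq h₁ h₂ =>
      obtain ⟨rfl, rfl⟩ := ih₁ h₁
      obtain ⟨rfl, rfl⟩ := ih₂ h₂
      exact ⟨rfl, rfl⟩
  | cond_true hc _ ih =>
    cases h' with
    | cond_true _ h₁ => obtain ⟨rfl, rfl⟩ := ih h₁; exact ⟨rfl, rfl⟩
    | cond_false hc' _ => exact absurd hc' hc
  | cond_false hc _ ih =>
    cases h' with
    | cond_true hc' _ => exact absurd hc hc'
    | cond_false _ h₁ => obtain ⟨rfl, rfl⟩ := ih h₁; exact ⟨rfl, rfl⟩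
  | loop_true hc _ _ ih₁ ih₂ =>
    cases h' with
    | loop_true _ h₁ h₂ =>
      obtain ⟨rfl, rfl⟩ := ih₁ h₁
      obtain ⟨rfl, rfl⟩ := ih₂ h₂
      exact ⟨rfl, rfl⟩
    | loop_false hc' => exact absurd hc' hc
  | loop_false hc =>
    cases h' with
    | loop_true hc' _ _ => exact absurd hc hc'
    | loop_false _ => exact ⟨rfl, rfl⟩

/-- The memory holds the instance `(B, k)`: registers `0`, `1`, `2` contain the number of rows, the
number of columns and `k`, and array `0` starts with the entries of `B`, row by row. -/
def State.Holds {n m : ℕ} (σ : State) (B : Matrix (Fin n) (Fin m) ℕ) (k : ℕ) : Prop :=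
  σ.var 0 = n ∧ σ.var 1 = m ∧ σ.var 2 = k ∧
  ∀ (i : Fin n) (j : Fin m), σ.arr 0 ((i : ℕ) * m + j) = B i j

/-- The initial memory on the instance `(B, k)`: it holds the instance, in the sense of
`State.Holds`, and is zero everywhere else. -/
def inputState {n m : ℕ} (B : Matrix (Fin n) (Fin m) ℕ) (k : ℕ) : State where
  var x := if x = 0 then n else if x = 1 then m else if x = 2 then k else 0
  arr a c :=
    if h : a = 0 ∧ c < n * m then
      B (finProdFinEquiv.symm ⟨c, h.2⟩).1 (finProdFinEquiv.symm ⟨c, h.2⟩).2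
    else 0

theorem inputState_holds {n m : ℕ} (B : Matrix (Fin n) (Fin m) ℕ) (k : ℕ) :
    (inputState B k).Holds B k := by
  refine ⟨rfl, rfl, rfl, fun i j => ?_⟩
  have hlt : (i : ℕ) * m + j < n * m := by
    have h := (finProdFinEquiv (i, j)).isLt
    rw [finProdFinEquiv_apply_val] at h
    linarith [mul_comm m (i : ℕ)]
  have he : (⟨(i : ℕ) * m + j, hlt⟩ : Fin (n * m)) = finProdFinEquiv (i, j) := by
    ext
    rw [finProdFinEquiv_apply_val]
    linarith [mul_comm m (i : ℕ)]
  simp only [inputState]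
  rw [dif_pos ⟨trivial, hlt⟩, he, finProdFinEquiv.symm_apply_apply]

/-- `P` decides Orthogonal Buttons and Scissors: on `(B, k)` it halts within time `T n m k`, where
`n × m` is the size of `B`, with the answer (`1` for yes and `0` for no) in register `0`. -/
def DecidesInTime (P : Program) (T : ℕ → ℕ → ℕ → ℝ) : Prop :=
  ∀ (n m : ℕ) (B : Matrix (Fin n) (Fin m) ℕ) (k : ℕ), ∃ (t : ℕ) (τ : State),
    Exec P (inputState B k) t τ ∧ (t : ℝ) ≤ T n m k ∧
    (Solvable B k → τ.var 0 = 1) ∧ (¬ Solvable B k → τ.var 0 = 0)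

/-- `P` shrinks instances of Orthogonal Buttons and Scissors: on `(B, k)` it halts within time
`T n m`, where `n × m` is the size of `B`, and leaves in the memory an equivalent instance
`(B', k)` whose grid is no larger and has at most `size k` buttons. -/
def ShrinksInTime (P : Program) (T : ℕ → ℕ → ℝ) (size : ℕ → ℝ) : Prop :=
  ∀ (n m : ℕ) (B : Matrix (Fin n) (Fin m) ℕ) (k : ℕ), ∃ (t : ℕ) (τ : State),
    Exec P (inputState B k) t τ ∧ (t : ℝ) ≤ T n m ∧
    ∃ (n' m' : ℕ) (B' : Matrix (Fin n') (Fin m') ℕ), n' ≤ n ∧ m' ≤ m ∧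
      τ.Holds B' k ∧ (Solvable B' k ↔ Solvable B k) ∧ (numButtons B' : ℝ) ≤ size k

end ButtonsScissors

/-!
Two columns `c` and `c'` of a grid are twins if they have the same entries and if, in each row in
which they contain a button, all the buttons between them have its colour. If `c` has more than `k`
twins, then the buttons of `c` may be deleted without changing the answer: a solution of the
remaining instance with at most `k` cuts leaves some twin `c'` without a vertical cut, so each
button `(r, c')` is removed by a horizontal cut, and this cut can be extended to `(r, c)`, because
all the buttons that it passes have the same colour (`solvable_zeroCol`). The extended cuts remove
more than the original ones did, but this does no harm, since deleting buttons never destroys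
solvability.

One pass over all the columns leaves at most `k + 1` nonempty columns in each class of twins. In a
yes-instance there are few classes: the ends of the at most `k` cuts divide the columns into at most
`2 k + 1` zones; two different columns of one zone meet no vertical cut, hence have buttons only in
the at most `k` rows of horizontal cuts; and between them a row contains buttons of one colour only,
since each horizontal cut covers all or nothing of the zone (`Clears.eq_of_no_break`). So columns in
the same zone with buttons in the same rows are twins, and at most `2 * 8 ^ k` nonempty columns
survive. The same applies to the rows, which leaves at most `4 * 64 ^ k` buttons; a grid with more
buttons is a no-instance and is replaced by `k + 1` buttons of different colours
(`solvable_reduced`, `numButtons_reduced_le`). A breadth-first search through the sequences of at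
most `k` cuts, each of them given by a pair of buttons, then decides the reduced instance after
visiting at most `(k + 1) ((4 * 64 ^ k) ^ 2 + 1) ^ k` grids.

The programs are written in a language of expressions with bounded sums and of loops whose length is
`n` or `m`. It is translated into programs of the machine once and for all; the translation is
correct (`Stmt.compile_exec`), and its running time is polynomial in `n + m` by the mere form of the
text (`Stmt.polyBounded_time`). Only the loops of the search over the levels of the tree and over
the grids in the queue are analysed directly.
-/

namespace ButtonsScissors

/-! ### A language of bounded loops -/

@[simp] theorem State.setVar_var (σ : State) (x v y : ℕ) :
    (σ.setVar x v).var y = if y = x then v else σ.var y := by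
  simp [State.setVar, Function.update_apply]

@[simp] theorem State.setVar_arr (σ : State) (x v : ℕ) : (σ.setVar x v).arr = σ.arr := rfl

@[simp] theorem State.setArr_var (σ : State) (a i v : ℕ) : (σ.setArr a i v).var = σ.var := rfl

theorem State.setArr_arr (σ : State) (a i v b p : ℕ) :
    (σ.setArr a i v).arr b p = if b = a ∧ p = i then v else σ.arr b p := by
  by_cases hb : b = a
  · subst hb; simp [State.setArr, Function.update_apply]
  · simp [State.setArr, hb]

/-- Repetition of `P` for `x = 0, 1, …` as long as `x` is smaller than the content of register
`b`. -/
def forLoop (x b : ℕ) (P : Program) : Program :=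
  .seq (.assign x (.lit 0))
    (.loop (.isLt (.var x) (.var b)) (.seq P (.assign x (.add (.var x) (.lit 1)))))

/-- The invariant rule for `forLoop`, with a bound for the running time: each round costs `8` on top
of its body, for the test and the increment, and the initialization and the last test cost `6`. -/
theorem forLoop_exec {x b T N : ℕ} {P : Program} (I : ℕ → State → Prop) {σ : State}
    (hxb : x ≠ b) (hN : σ.var b = N) (h0 : I 0 (σ.setVar x 0))
    (step : ∀ i < N, ∀ τ, I i τ → τ.var x = i → τ.var b = N →
      ∃ t ρ, Exec P τ t ρ ∧ t ≤ T ∧ ρ.var x = i ∧ ρ.var b = N ∧ I (i + 1) (ρ.setVar x (i + 1))) :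
    ∃ t τ, Exec (forLoop x b P) σ t τ ∧ t ≤ N * (T + 8) + 6 ∧ I N τ ∧ τ.var x = N ∧
      τ.var b = N := by
  have key : ∀ r i τ, i + r = N → I i τ → τ.var x = i → τ.var b = N →
      ∃ t ρ, Exec (.loop (.isLt (.var x) (.var b)) (.seq P (.assign x (.add (.var x) (.lit 1)))))
        τ t ρ ∧ t ≤ r * (T + 8) + 4 ∧ I N ρ ∧ ρ.var x = N ∧ ρ.var b = N := by
    intro r
    induction r with
    | zero =>
      intro i τ hi hI hx hb
      obtain rfl : i = N := by omega
      refine ⟨_, τ, Exec.loop_false ?_, ?_, hI, hx, hb⟩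
      · simp [Expr.eval, hx, hb]
      · simp [Expr.cost]
    | succ r ih =>
      intro i τ hi hI hx hb
      obtain ⟨t₁, ρ, h₁, ht₁, hρx, hρb, hI'⟩ := step i (by omega) τ hI hx hb
      obtain ⟨t₂, ρ', h₂, ht₂, hρ'⟩ := ih (i + 1) (ρ.setVar x (i + 1)) (by omega) hI' (by simp)
        (by simp [hxb.symm, hρb])
      have h₃ : Exec (.assign x (.add (.var x) (.lit 1))) ρ 4 (ρ.setVar x (i + 1)) := by
        have := Exec.assign x (.add (.var x) (.lit 1)) ρ
        simpa [Expr.eval, Expr.cost, hρx] using this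
      refine ⟨_, ρ', Exec.loop_true ?_ (Exec.seq h₁ h₃) h₂, ?_, hρ'⟩
      · simp [Expr.eval, hx, hb]; omega
      · simp only [Expr.cost]
        have : (r + 1) * (T + 8) = r * (T + 8) + (T + 8) := by ring
        omega
  obtain ⟨t, τ, h, ht, hτ⟩ := key N 0 (σ.setVar x 0) (by omega) h0 (by simp)
    (by simp [hxb.symm, hN])
  refine ⟨_, τ, Exec.seq (Exec.assign x (.lit 0) σ) h, ?_, hτ⟩
  simp only [Expr.cost]
  omega

/-- Expressions enriched by case distinctions and by the sums `∑ x < b, e`, where `b` is a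
register. -/
inductive SumExpr where
  | lit (c : ℕ)
  | var (x : ℕ)
  | get (a : ℕ) (e : SumExpr)
  | add (e₁ e₂ : SumExpr)
  | sub (e₁ e₂ : SumExpr)
  | isEq (e₁ e₂ : SumExpr)
  | isLt (e₁ e₂ : SumExpr)
  | ite (e e₁ e₂ : SumExpr)
  | sum (x b : ℕ) (e : SumExpr)

namespace SumExpr

/-- The value of an expression. -/
def eval : SumExpr → State → ℕ
  | lit c, _ => c
  | var x, σ => σ.var x
  | get a e, σ => σ.arr a (e.eval σ)
  | add e₁ e₂, σ => e₁.eval σ + e₂.eval σ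
  | sub e₁ e₂, σ => e₁.eval σ - e₂.eval σ
  | isEq e₁ e₂, σ => if e₁.eval σ = e₂.eval σ then 1 else 0
  | isLt e₁ e₂, σ => if e₁.eval σ < e₂.eval σ then 1 else 0
  | ite e e₁ e₂, σ => if e.eval σ ≠ 0 then e₁.eval σ else e₂.eval σ
  | sum x b e, σ => ∑ i ∈ Finset.range (σ.var b), e.eval (σ.setVar x i)

/-- The program that writes the value of an expression into register `d`. It uses the registers
from `d` on as a stack, and restores all the registers below `d`. -/
def compile : SumExpr → ℕ → Program
  | lit c, d => .assign d (.lit c)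
  | var x, d => .assign d (.var x)
  | get a e, d => .seq (e.compile d) (.assign d (.get a (.var d)))
  | add e₁ e₂, d => .seq (e₁.compile d) (.seq (e₂.compile (d + 1))
      (.assign d (.add (.var d) (.var (d + 1)))))
  | sub e₁ e₂, d => .seq (e₁.compile d) (.seq (e₂.compile (d + 1))
      (.assign d (.sub (.var d) (.var (d + 1)))))
  | isEq e₁ e₂, d => .seq (e₁.compile d) (.seq (e₂.compile (d + 1))
      (.assign d (.isEq (.var d) (.var (d + 1)))))
  | isLt e₁ e₂, d => .seq (e₁.compile d) (.seq (e₂.compile (d + 1))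
      (.assign d (.isLt (.var d) (.var (d + 1)))))
  | ite e e₁ e₂, d => .seq (e.compile d) (.cond (.var d) (e₁.compile d) (e₂.compile d))
  | sum x b e, d => .seq (.assign d (.var x)) (.seq (.assign (d + 1) (.lit 0))
      (.seq (forLoop x b (.seq (e.compile (d + 2))
        (.assign (d + 1) (.add (.var (d + 1)) (.var (d + 2))))))
      (.seq (.assign x (.var d)) (.assign d (.var (d + 1))))))

/-- A bound for the running time of `compile` when the registers `0` and `1`, which bound the sums,
contain at most `N`. -/
def time : SumExpr → ℕ → ℕ
  | lit _, _ => 2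
  | var _, _ => 2
  | get _ e, N => e.time N + 3
  | add e₁ e₂, N => e₁.time N + e₂.time N + 4
  | sub e₁ e₂, N => e₁.time N + e₂.time N + 4
  | isEq e₁ e₂, N => e₁.time N + e₂.time N + 4
  | isLt e₁ e₂, N => e₁.time N + e₂.time N + 4
  | ite e e₁ e₂, N => e.time N + e₁.time N + e₂.time N + 2
  | sum _ _ e, N => N * (e.time N + 12) + 14

end SumExpr

/-- The registers from this one on are used for intermediate results only. -/
def scratch : ℕ := 20

/-- The expression uses no scratch registers, and its sums have the register `0` or `1` as a bound
and use other registers as summation indices. -/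
def SumExpr.wf : SumExpr → Bool
  | lit _ => true
  | var x => x < scratch
  | get _ e => e.wf
  | add e₁ e₂ => e₁.wf && e₂.wf
  | sub e₁ e₂ => e₁.wf && e₂.wf
  | isEq e₁ e₂ => e₁.wf && e₂.wf
  | isLt e₁ e₂ => e₁.wf && e₂.wf
  | ite e e₁ e₂ => e.wf && e₁.wf && e₂.wf
  | sum x b e => decide (2 ≤ x) && decide (x < scratch) && decide (b < 2) && e.wf

/-- The two memories agree except possibly for scratch registers. -/
structure Agree (σ τ : State) : Prop where
  arr : σ.arr = τ.arr
  var : ∀ y < scratch, σ.var y = τ.var y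

theorem Agree.setVar {σ τ : State} (h : Agree σ τ) (x v : ℕ) :
    Agree (σ.setVar x v) (τ.setVar x v) :=
  ⟨h.arr, fun y hy => by simp [h.var y hy]⟩

theorem SumExpr.eval_congr {e : SumExpr} (he : e.wf = true) {σ τ : State} (h : Agree σ τ) :
    e.eval σ = e.eval τ := by
  induction e generalizing σ τ with
  | lit c => rfl
  | var x => exact h.var x (by simpa [wf] using he)
  | get a e ih => simp only [eval, ih (by simpa [wf] using he) h, h.arr]
  | add e₁ e₂ ih₁ ih₂ | sub e₁ e₂ ih₁ ih₂ | isEq e₁ e₂ ih₁ ih₂ | isLt e₁ e₂ ih₁ ih₂ =>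
    simp only [wf, Bool.and_eq_true] at he
    simp only [eval, ih₁ he.1 h, ih₂ he.2 h]
  | ite e e₁ e₂ ih ih₁ ih₂ =>
    simp only [wf, Bool.and_eq_true] at he
    simp only [eval, ih he.1.1 h, ih₁ he.1.2 h, ih₂ he.2 h]
  | sum x b e ih =>
    simp only [wf, Bool.and_eq_true, decide_eq_true_eq] at he
    simp only [eval]
    rw [h.var b (by have := he.1.2; unfold scratch; omega)]
    exact Finset.sum_congr rfl fun i _ => ih he.2 (h.setVar x i)

/-- Correctness and running time of a binary operation of the machine. -/
theorem compile_binary_exec {e₁ e₂ : SumExpr} {d T₁ T₂ : ℕ} {σ : State}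
    (op : Expr → Expr → Expr) (f : ℕ → ℕ → ℕ)
    (hop : ∀ a b τ, (op a b).eval τ = f (a.eval τ) (b.eval τ))
    (hcost : ∀ a b, (op a b).cost = a.cost + b.cost + 1) {v₁ v₂ : ℕ}
    (h₁ : ∃ t τ, Exec (e₁.compile d) σ t τ ∧ t ≤ T₁ ∧ τ.arr = σ.arr ∧
      (∀ y < d, τ.var y = σ.var y) ∧ τ.var d = v₁)
    (h₂ : ∀ τ : State, τ.arr = σ.arr → (∀ y < d, τ.var y = σ.var y) →
      ∃ t ρ, Exec (e₂.compile (d + 1)) τ t ρ ∧ t ≤ T₂ ∧ ρ.arr = τ.arr ∧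
      (∀ y < d + 1, ρ.var y = τ.var y) ∧ ρ.var (d + 1) = v₂) :
    ∃ t τ, Exec (.seq (e₁.compile d) (.seq (e₂.compile (d + 1))
        (.assign d (op (.var d) (.var (d + 1)))))) σ t τ ∧ t ≤ T₁ + T₂ + 4 ∧ τ.arr = σ.arr ∧
      (∀ y < d, τ.var y = σ.var y) ∧ τ.var d = f v₁ v₂ := by
  obtain ⟨t₁, τ, e₁, ht₁, ha₁, hv₁, hr₁⟩ := h₁
  obtain ⟨t₂, ρ, e₂, ht₂, ha₂, hv₂, hr₂⟩ := h₂ τ ha₁ hv₁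
  refine ⟨_, _, Exec.seq e₁ (Exec.seq e₂ (Exec.assign _ _ _)), ?_, ?_, ?_, ?_⟩
  · simp only [hcost, Expr.cost]; omega
  · simp [ha₁, ha₂]
  · intro y hy
    simp [hy.ne, hv₂ y (by omega), hv₁ y hy]
  · simp [hop, Expr.eval, hr₂, hv₂ d (by omega), hr₁]

/-- Correctness and running time of the evaluation of expressions. -/
theorem SumExpr.compile_exec {e : SumExpr} (he : e.wf = true) {d N : ℕ} (hd : scratch ≤ d)
    {σ : State} (h0 : σ.var 0 ≤ N) (h1 : σ.var 1 ≤ N) :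
    ∃ t τ, Exec (e.compile d) σ t τ ∧ t ≤ e.time N ∧ τ.arr = σ.arr ∧
      (∀ y < d, τ.var y = σ.var y) ∧ τ.var d = e.eval σ := by
  have hs : scratch = 20 := rfl
  induction e generalizing σ d with
  | lit c =>
    exact ⟨_, _, Exec.assign _ _ _, le_rfl, rfl, fun y hy => by simp [hy.ne], by
      simp [eval, Expr.eval]⟩
  | var x =>
    exact ⟨_, _, Exec.assign _ _ _, le_rfl, rfl, fun y hy => by simp [hy.ne], by
      simp [eval, Expr.eval]⟩
  | get a e ih =>
    obtain ⟨t, τ, hx, ht, ha, hv, hr⟩ := ih (by simpa [wf] using he) hd h0 h1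
    refine ⟨_, _, Exec.seq hx (Exec.assign _ _ _), ?_, ?_, ?_, ?_⟩
    · simp only [Expr.cost, time]; omega
    · simp [ha]
    · intro y hy; simp [hy.ne, hv y hy]
    · simp [eval, Expr.eval, hr, ha]
  | add e₁ e₂ ih₁ ih₂ | sub e₁ e₂ ih₁ ih₂ | isEq e₁ e₂ ih₁ ih₂ | isLt e₁ e₂ ih₁ ih₂ =>
    simp only [wf, Bool.and_eq_true] at he
    simp only [compile, time, eval]
    have h₂ : ∀ τ : State, τ.arr = σ.arr → (∀ y < d, τ.var y = σ.var y) →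
        ∃ t ρ, Exec (e₂.compile (d + 1)) τ t ρ ∧ t ≤ e₂.time N ∧ ρ.arr = τ.arr ∧
        (∀ y < d + 1, ρ.var y = τ.var y) ∧ ρ.var (d + 1) = e₂.eval σ := by
      intro τ ha hv
      rw [← eval_congr he.2 (σ := τ) ⟨ha, fun y hy => hv y (by omega)⟩]
      exact ih₂ he.2 (by omega) (by rw [hv 0 (by omega)]; exact h0)
        (by rw [hv 1 (by omega)]; exact h1)
    first
    | exact compile_binary_exec .add (· + ·) (fun _ _ _ => rfl) (fun _ _ => rfl)
        (ih₁ he.1 hd h0 h1) h₂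
    | exact compile_binary_exec .sub (· - ·) (fun _ _ _ => rfl) (fun _ _ => rfl)
        (ih₁ he.1 hd h0 h1) h₂
    | exact compile_binary_exec .isEq (fun a b => if a = b then 1 else 0) (fun _ _ _ => rfl)
        (fun _ _ => rfl) (ih₁ he.1 hd h0 h1) h₂
    | exact compile_binary_exec .isLt (fun a b => if a < b then 1 else 0) (fun _ _ _ => rfl)
        (fun _ _ => rfl) (ih₁ he.1 hd h0 h1) h₂
  | ite e e₁ e₂ ih ih₁ ih₂ =>
    simp only [wf, Bool.and_eq_true] at he
    obtain ⟨t, τ, hx, ht, ha, hv, hr⟩ := ih he.1.1 hd h0 h1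
    have hag : Agree τ σ := ⟨ha, fun y hy => hv y (by omega)⟩
    have h0' : τ.var 0 ≤ N := by rw [hv 0 (by omega)]; exact h0
    have h1' : τ.var 1 ≤ N := by rw [hv 1 (by omega)]; exact h1
    by_cases hc : e.eval σ = 0
    · obtain ⟨t₂, ρ, hx₂, ht₂, ha₂, hv₂, hr₂⟩ := ih₂ he.2 hd h0' h1'
      refine ⟨_, _, Exec.seq hx (Exec.cond_false (by simp [Expr.eval, hr, hc]) hx₂), ?_, ?_, ?_, ?_⟩
      · simp only [Expr.cost, time]; omega
      · rw [ha₂, ha]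
      · intro y hy; rw [hv₂ y hy, hv y hy]
      · rw [hr₂, eval_congr he.2 hag]; simp [eval, hc]
    · obtain ⟨t₂, ρ, hx₂, ht₂, ha₂, hv₂, hr₂⟩ := ih₁ he.1.2 hd h0' h1'
      refine ⟨_, _, Exec.seq hx (Exec.cond_true (by simp [Expr.eval, hr, hc]) hx₂), ?_, ?_, ?_, ?_⟩
      · simp only [Expr.cost, time]; omega
      · rw [ha₂, ha]
      · intro y hy; rw [hv₂ y hy, hv y hy]
      · rw [hr₂, eval_congr he.1.2 hag]; simp [eval, hc]
  | sum x b e ih =>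
    simp only [wf, Bool.and_eq_true, decide_eq_true_eq] at he
    obtain ⟨⟨⟨hx2, hxs⟩, hb⟩, hw⟩ := he
    set σ₁ := (σ.setVar d (σ.var x)).setVar (d + 1) 0 with hσ₁
    have hbN : σ.var b ≤ N := by interval_cases b <;> assumption
    have hb₁ : σ₁.var b = σ.var b := by simp [hσ₁, show b ≠ d + 1 by omega, show b ≠ d by omega]
    obtain ⟨t, τ, hx, ht, hI, -, -⟩ := forLoop_exec (x := x) (b := b) (T := e.time N + 4)
      (P := .seq (e.compile (d + 2)) (.assign (d + 1) (.add (.var (d + 1)) (.var (d + 2)))))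
      (fun i τ => τ.arr = σ.arr ∧ (∀ y < d, y ≠ x → τ.var y = σ.var y) ∧ τ.var d = σ.var x ∧
        τ.var (d + 1) = ∑ i ∈ Finset.range i, e.eval (σ.setVar x i))
      (σ := σ₁) (by omega) hb₁
      ⟨rfl, fun y hy hyx => by simp [hσ₁, hyx, hy.ne, show y ≠ d + 1 by omega],
        by simp [hσ₁, show d ≠ x by omega], by simp [hσ₁, show d + 1 ≠ x by omega]⟩
      (by
        rintro i hi τ ⟨ha, hv, hs', hr⟩ hτx hτb
        obtain ⟨t, ρ, hx, ht, ha', hv', hr'⟩ := ih hw (d := d + 2) (σ := τ) (by omega)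
          (by rw [hv 0 (by omega) (by omega)]; exact h0)
          (by rw [hv 1 (by omega) (by omega)]; exact h1)
        have hag : Agree τ (σ.setVar x i) := ⟨ha, fun y hy => by
          by_cases hyx : y = x
          · simp [hyx, hτx]
          · simp [hyx, hv y (by omega) hyx]⟩
        refine ⟨_, _, Exec.seq hx (Exec.assign _ _ _), ?_, ?_, ?_, ?_, ?_, ?_, ?_⟩
        · simp only [Expr.cost]; omega
        · simp [show x ≠ d + 1 by omega, hv' x (by omega), hτx]
        · simp [show b ≠ d + 1 by omega, hv' b (by omega), hτb]
        · simp [ha', ha]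
        · intro y hy hyx
          simp [hyx, show y ≠ d + 1 by omega, hv' y (by omega), hv y hy hyx]
        · simp [show d ≠ x by omega, hv' d (by omega), hs']
        · simp [show d + 1 ≠ x by omega, Expr.eval, hv' (d + 1) (by omega), hr, hr',
            Finset.sum_range_succ, eval_congr hw hag])
    obtain ⟨ha, hv, hs', hr⟩ := hI
    refine ⟨_, _, Exec.seq (Exec.assign _ _ _) (Exec.seq (Exec.assign _ _ _)
      (Exec.seq hx (Exec.seq (Exec.assign _ _ _) (Exec.assign _ _ _)))), ?_, ?_, ?_, ?_⟩
    · simp only [Expr.cost, time]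
      have : σ.var b * (e.time N + 4 + 8) ≤ N * (e.time N + 12) := Nat.mul_le_mul hbN le_rfl
      omega
    · simp [ha]
    · intro y hy
      by_cases hyx : y = x
      · simp [hyx, Expr.eval, hs', show x ≠ d by omega]
      · simp [hyx, hy.ne, hv y hy hyx]
    · simp [Expr.eval, eval, show d + 1 ≠ x by omega, hr]

/-- Programs whose loops are bounded by the registers `0` and `1`. -/
inductive Stmt where
  | assign (x : ℕ) (e : SumExpr)
  | store (a : ℕ) (idx e : SumExpr)
  | seq (s₁ s₂ : Stmt)
  | iterate (x b : ℕ) (s : Stmt)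

namespace Stmt

/-- The translation into programs of the machine. -/
def compile : Stmt → Program
  | assign x e => .seq (e.compile scratch) (.assign x (.var scratch))
  | store a i e => .seq (i.compile scratch) (.seq (e.compile (scratch + 1))
      (.store a (.var scratch) (.var (scratch + 1))))
  | seq s₁ s₂ => .seq s₁.compile s₂.compile
  | iterate x b s => forLoop x b s.compile

/-- The meaning of a statement, as a map of memories. -/
def den : Stmt → State → State
  | assign x e, σ => σ.setVar x (e.eval σ)
  | store a i e, σ => σ.setArr a (i.eval σ) (e.eval σ)
  | seq s₁ s₂, σ => s₂.den (s₁.den σ)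
  | iterate x b s, σ => Nat.rec (σ.setVar x 0) (fun i τ => (s.den τ).setVar x (i + 1)) (σ.var b)

/-- A bound for the running time when the registers `0` and `1` contain at most `N`. -/
def time : Stmt → ℕ → ℕ
  | assign _ e, N => e.time N + 2
  | store _ i e, N => i.time N + e.time N + 3
  | seq s₁ s₂, N => s₁.time N + s₂.time N
  | iterate _ _ s, N => N * (s.time N + 8) + 6

/-- Does the statement assign to register `y`? -/
def writes (y : ℕ) : Stmt → Bool
  | assign x _ => x == y
  | store _ _ _ => false
  | seq s₁ s₂ => s₁.writes y || s₂.writes y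
  | iterate x _ s => x == y || s.writes y

/-- The statement uses no scratch registers, its loops have the register `0` or `1` as a bound, and
it changes neither these nor, within a loop, the counter of the loop. -/
def wf : Stmt → Bool
  | assign x e => decide (2 ≤ x) && decide (x < scratch) && e.wf
  | store _ i e => i.wf && e.wf
  | seq s₁ s₂ => s₁.wf && s₂.wf
  | iterate x b s => decide (2 ≤ x) && decide (x < scratch) && decide (b < 2) && s.wf && !s.writes x

theorem den_var {s : Stmt} {y : ℕ} (h : s.writes y = false) (σ : State) :
    (s.den σ).var y = σ.var y := by
  induction s generalizing σ with
  | assign x e => simp [writes] at h; simp [den, Ne.symm h]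
  | store a i e => rfl
  | seq s₁ s₂ ih₁ ih₂ =>
    simp only [writes, Bool.or_eq_false_iff] at h
    simp [den, ih₂ h.2, ih₁ h.1]
  | iterate x b s ih =>
    simp only [writes, Bool.or_eq_false_iff, beq_eq_false_iff_ne] at h
    simp only [den]
    induction σ.var b with
    | zero => simp [Ne.symm h.1]
    | succ i ih' => simp [Ne.symm h.1, ih h.2, ih']

theorem writes_eq_false {s : Stmt} (h : s.wf = true) {y : ℕ} (hy : y < 2) : s.writes y = false := by
  induction s with
  | assign x e => simp [wf] at h; simp [writes]; omega
  | store a i e => rfl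
  | seq s₁ s₂ ih₁ ih₂ => simp [wf] at h; simp [writes, ih₁ h.1, ih₂ h.2]
  | iterate x b s ih => simp [wf] at h; simp [writes, ih h.1.2]; omega

/-- The invariant rule for loops. -/
theorem den_iterate {x b N : ℕ} {s : Stmt} (I : ℕ → State → Prop) {σ : State} (hN : σ.var b = N)
    (h0 : I 0 (σ.setVar x 0))
    (step : ∀ i < N, ∀ τ, I i τ → τ.var x = i → I (i + 1) ((s.den τ).setVar x (i + 1))) :
    I N ((Stmt.iterate x b s).den σ) := by
  simp only [den, hN]
  have : ∀ i ≤ N, I i (Nat.rec (σ.setVar x 0) (fun i τ => (s.den τ).setVar x (i + 1)) i : State) ∧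
      (Nat.rec (σ.setVar x 0) (fun i τ => (s.den τ).setVar x (i + 1)) i : State).var x = i := by
    intro i
    induction i with
    | zero => exact fun _ => ⟨h0, by simp⟩
    | succ i ih =>
      intro hi
      obtain ⟨h₁, h₂⟩ := ih (by omega)
      exact ⟨step i (by omega) _ h₁ h₂, by simp⟩
  exact (this N le_rfl).1

/-- Correctness and running time of the translation. The meaning is only determined up to the
scratch registers. -/
theorem compile_exec {s : Stmt} (hs : s.wf = true) {N : ℕ} {σ σ' : State} (hσ : Agree σ σ')
    (h0 : σ.var 0 ≤ N) (h1 : σ.var 1 ≤ N) :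
    ∃ t τ, Exec s.compile σ t τ ∧ t ≤ s.time N ∧ Agree τ (s.den σ') := by
  have hsc : scratch = 20 := rfl
  induction s generalizing σ σ' with
  | assign x e =>
    simp only [wf, Bool.and_eq_true, decide_eq_true_eq] at hs
    obtain ⟨t, τ, hx, ht, ha, hv, hr⟩ := e.compile_exec hs.2 le_rfl h0 h1
    refine ⟨_, _, Exec.seq hx (Exec.assign _ _ _), ?_, ?_⟩
    · simp only [Expr.cost, time]; omega
    · simp only [Expr.eval, hr, den, e.eval_congr hs.2 hσ]
      exact Agree.setVar ⟨ha.trans hσ.arr, fun y hy => (hv y hy).trans (hσ.var y hy)⟩ _ _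
  | store a i e =>
    simp only [wf, Bool.and_eq_true] at hs
    obtain ⟨t, τ, hx, ht, ha, hv, hr⟩ := i.compile_exec hs.1 le_rfl h0 h1
    obtain ⟨t', ρ, hx', ht', ha', hv', hr'⟩ := e.compile_exec hs.2 (d := scratch + 1) (N := N)
      (σ := τ) (by omega) (by rw [hv 0 (by omega)]; exact h0) (by rw [hv 1 (by omega)]; exact h1)
    refine ⟨_, _, Exec.seq hx (Exec.seq hx' (Exec.store _ _ _ _)), ?_, ?_⟩
    · simp only [Expr.cost, time]; omega
    · have hag : Agree τ σ' := ⟨ha.trans hσ.arr, fun y hy => (hv y hy).trans (hσ.var y hy)⟩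
      simp only [Expr.eval, hr, hr', den, hv' scratch (by omega), i.eval_congr hs.1 hσ,
        e.eval_congr hs.2 hag]
      refine ⟨?_, fun y hy => ?_⟩
      · simp [State.setArr, ha', ha, hσ.arr]
      · simp [hv' y (by omega), hag.var y hy]
  | seq s₁ s₂ ih₁ ih₂ =>
    simp only [wf, Bool.and_eq_true] at hs
    obtain ⟨t, τ, hx, ht, ha⟩ := ih₁ hs.1 hσ h0 h1
    have hb : ∀ y < 2, τ.var y ≤ N := by
      intro y hy
      rw [ha.var y (by omega), den_var (writes_eq_false hs.1 hy), ← hσ.var y (by omega)]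
      interval_cases y <;> assumption
    obtain ⟨t', ρ, hx', ht', ha'⟩ := ih₂ hs.2 ha (hb 0 (by omega)) (hb 1 (by omega))
    exact ⟨_, _, Exec.seq hx hx', by simp only [time]; omega, ha'⟩
  | iterate x b s ih =>
    simp only [wf, Bool.and_eq_true, decide_eq_true_eq, Bool.not_eq_true'] at hs
    obtain ⟨⟨⟨⟨hx2, hxs⟩, hb⟩, hw⟩, hwr⟩ := hs
    have hbN : σ.var b ≤ N := by interval_cases b <;> assumption
    obtain ⟨t, τ, hx, ht, hI, -, -⟩ := forLoop_exec (x := x) (b := b) (T := s.time N)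
      (P := s.compile)
      (fun i τ => Agree τ (Nat.rec (σ'.setVar x 0) (fun i τ => (s.den τ).setVar x (i + 1)) i) ∧
        ∀ y < 2, τ.var y = σ.var y)
      (σ := σ) (by omega) rfl
      ⟨hσ.setVar _ _, fun y hy => by simp [show y ≠ x by omega]⟩
      (by
        rintro i hi τ ⟨ha, hv⟩ hτx hτb
        obtain ⟨t, ρ, hx, ht, ha'⟩ := ih hw ha (by rw [hv 0 (by omega)]; exact h0)
          (by rw [hv 1 (by omega)]; exact h1)
        have hρ : ∀ y < 2, ρ.var y = τ.var y := by
          intro y hy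
          rw [ha'.var y (by omega), den_var (writes_eq_false hw hy), ← ha.var y (by omega)]
        refine ⟨_, _, hx, ht, ?_, ?_, ha'.setVar _ _, ?_⟩
        · rw [ha'.var x hxs, den_var hwr, ← ha.var x hxs, hτx]
        · rw [hρ b hb, hτb]
        · intro y hy; simp [show y ≠ x by omega, hρ y hy, hv y hy])
    refine ⟨_, _, hx, ?_, ?_⟩
    · simp only [time]
      have : σ.var b * (s.time N + 8) ≤ N * (s.time N + 8) := Nat.mul_le_mul hbN le_rfl
      omega
    · simpa only [den, ← hσ.var b (by omega)] using hI.1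

end Stmt

/-- The function is bounded by a polynomial. -/
def PolyBounded (f : ℕ → ℕ) : Prop := ∃ C, ∀ N, f N ≤ C * (N + 1) ^ C

namespace PolyBounded

theorem const (c : ℕ) : PolyBounded fun _ => c :=
  ⟨c, fun N => Nat.le_mul_of_pos_right c (by positivity)⟩

theorem add {f g : ℕ → ℕ} (hf : PolyBounded f) (hg : PolyBounded g) :
    PolyBounded fun N => f N + g N := by
  obtain ⟨C, hC⟩ := hf
  obtain ⟨D, hD⟩ := hg
  refine ⟨C + D, fun N => ?_⟩
  calc f N + g N ≤ C * (N + 1) ^ C + D * (N + 1) ^ D := Nat.add_le_add (hC N) (hD N)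
    _ ≤ C * (N + 1) ^ (C + D) + D * (N + 1) ^ (C + D) := by
      gcongr <;> omega
    _ = _ := by ring

theorem mul {f g : ℕ → ℕ} (hf : PolyBounded f) (hg : PolyBounded g) :
    PolyBounded fun N => f N * g N := by
  obtain ⟨C, hC⟩ := hf
  obtain ⟨D, hD⟩ := hg
  refine ⟨C * D + C + D, fun N => ?_⟩
  calc f N * g N ≤ (C * (N + 1) ^ C) * (D * (N + 1) ^ D) := Nat.mul_le_mul (hC N) (hD N)
    _ = C * D * (N + 1) ^ (C + D) := by ring
    _ ≤ (C * D + C + D) * (N + 1) ^ (C * D + C + D) := by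
      gcongr <;> nlinarith

theorem id : PolyBounded fun N => N :=
  ⟨1, fun N => by simp⟩

end PolyBounded

theorem SumExpr.polyBounded_time (e : SumExpr) : PolyBounded e.time := by
  induction e with
  | lit c => exact .const _
  | var x => exact .const _
  | get a e ih => exact ih.add (.const _)
  | add e₁ e₂ ih₁ ih₂ | sub e₁ e₂ ih₁ ih₂ | isEq e₁ e₂ ih₁ ih₂ | isLt e₁ e₂ ih₁ ih₂ =>
    exact (ih₁.add ih₂).add (.const _)
  | ite e e₁ e₂ ih ih₁ ih₂ => exact ((ih.add ih₁).add ih₂).add (.const _)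
  | sum x b e ih => exact (PolyBounded.id.mul (ih.add (.const _))).add (.const _)

theorem Stmt.polyBounded_time (s : Stmt) : PolyBounded s.time := by
  induction s with
  | assign x e => exact e.polyBounded_time.add (.const _)
  | store a i e => exact (i.polyBounded_time.add e.polyBounded_time).add (.const _)
  | seq s₁ s₂ ih₁ ih₂ => exact ih₁.add ih₂
  | iterate x b s ih => exact (PolyBounded.id.mul (ih.add (.const _))).add (.const _)

/-! ### Cuts without conditions on their ends -/

section Combinatorics

variable {n m : ℕ}

/-- All the buttons of `B` in the cells of the segment have the same colour. -/
def Cut.IsMono (C : Cut n m) (B : Matrix (Fin n) (Fin m) ℕ) : Prop :=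
  ∀ p ∈ C.cells, ∀ q ∈ C.cells, B p.1 p.2 ≠ 0 → B q.1 q.2 ≠ 0 → B p.1 p.2 = B q.1 q.2

/-- The variant of `Clears` in which the ends of the segments need not contain buttons. -/
def WeaklyClears : List (Cut n m) → Matrix (Fin n) (Fin m) ℕ → Prop
  | [], B => B = 0
  | C :: S, B => C.IsMono B ∧ WeaklyClears S (C.apply B)

theorem Cut.apply_of_mem {C : Cut n m} {B : Matrix (Fin n) (Fin m) ℕ} {i : Fin n} {j : Fin m}
    (h : (i, j) ∈ C.cells) : C.apply B i j = 0 := if_pos h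

theorem Cut.apply_of_notMem {C : Cut n m} {B : Matrix (Fin n) (Fin m) ℕ} {i : Fin n} {j : Fin m}
    (h : (i, j) ∉ C.cells) : C.apply B i j = B i j := if_neg h

theorem Cut.apply_eq_or (C : Cut n m) (B : Matrix (Fin n) (Fin m) ℕ) (i : Fin n) (j : Fin m) :
    C.apply B i j = B i j ∨ C.apply B i j = 0 := by
  by_cases h : (i, j) ∈ C.cells
  · exact .inr (Cut.apply_of_mem h)
  · exact .inl (Cut.apply_of_notMem h)

@[simp] theorem Cut.mem_cells_horizontal {i : Fin n} {j₁ j₂ : Fin m} {p : Fin n × Fin m} :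
    p ∈ (Cut.horizontal i j₁ j₂).cells ↔ p.1 = i ∧ j₁ ≤ p.2 ∧ p.2 ≤ j₂ := by
  obtain ⟨a, b⟩ := p
  simp only [Cut.cells, Finset.mem_product, Finset.mem_singleton, Finset.mem_Icc]

@[simp] theorem Cut.mem_cells_vertical {i₁ i₂ : Fin n} {j : Fin m} {p : Fin n × Fin m} :
    p ∈ (Cut.vertical i₁ i₂ j).cells ↔ (i₁ ≤ p.1 ∧ p.1 ≤ i₂) ∧ p.2 = j := by
  obtain ⟨a, b⟩ := p
  simp only [Cut.cells, Finset.mem_product, Finset.mem_singleton, Finset.mem_Icc]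

/-- A segment that contains a button can be shrunk to its outermost buttons. -/
theorem Cut.exists_trimmed (C : Cut n m) {B : Matrix (Fin n) (Fin m) ℕ}
    (h : ∃ p ∈ C.cells, B p.1 p.2 ≠ 0) :
    ∃ D : Cut n m, D.cells ⊆ C.cells ∧ D.first ≤ D.last ∧ B D.first.1 D.first.2 ≠ 0 ∧
      B D.last.1 D.last.2 ≠ 0 ∧ ∀ p ∈ C.cells, B p.1 p.2 ≠ 0 → p ∈ D.cells := by
  cases C with
  | horizontal i j₁ j₂ =>
    set s := (Finset.Icc j₁ j₂).filter fun j => B i j ≠ 0 with hs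
    have hne : s.Nonempty := by
      obtain ⟨⟨a, b⟩, hp, hB⟩ := h
      rw [mem_cells_horizontal] at hp
      obtain ⟨rfl, hp⟩ := hp
      exact ⟨b, by simpa [hs] using ⟨hp, hB⟩⟩
    have h₁ := s.min'_mem hne
    have h₂ := s.max'_mem hne
    simp only [hs, Finset.mem_filter, Finset.mem_Icc] at h₁ h₂
    refine ⟨.horizontal i (s.min' hne) (s.max' hne), ?_, ⟨le_rfl, s.min'_le_max' hne⟩,
      h₁.2, h₂.2, ?_⟩
    · rintro ⟨a, b⟩ hab
      rw [mem_cells_horizontal] at hab ⊢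
      exact ⟨hab.1, h₁.1.1.trans hab.2.1, hab.2.2.trans h₂.1.2⟩
    · rintro ⟨a, b⟩ hab hB
      rw [mem_cells_horizontal] at hab ⊢
      obtain ⟨rfl, hab⟩ := hab
      have hb : b ∈ s := by simpa [hs] using ⟨hab, hB⟩
      exact ⟨rfl, s.min'_le b hb, s.le_max' b hb⟩
  | vertical i₁ i₂ j =>
    set s := (Finset.Icc i₁ i₂).filter fun i => B i j ≠ 0 with hs
    have hne : s.Nonempty := by
      obtain ⟨⟨a, b⟩, hp, hB⟩ := h
      rw [mem_cells_vertical] at hp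
      obtain ⟨hp, rfl⟩ := hp
      exact ⟨a, by simpa [hs] using ⟨hp, hB⟩⟩
    have h₁ := s.min'_mem hne
    have h₂ := s.max'_mem hne
    simp only [hs, Finset.mem_filter, Finset.mem_Icc] at h₁ h₂
    refine ⟨.vertical (s.min' hne) (s.max' hne) j, ?_, ⟨s.min'_le_max' hne, le_rfl⟩,
      h₁.2, h₂.2, ?_⟩
    · rintro ⟨a, b⟩ hab
      rw [mem_cells_vertical] at hab ⊢
      exact ⟨⟨h₁.1.1.trans hab.1.1, hab.1.2.trans h₂.1.2⟩, hab.2⟩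
    · rintro ⟨a, b⟩ hab hB
      rw [mem_cells_vertical] at hab ⊢
      obtain ⟨hab, rfl⟩ := hab
      have hb : a ∈ s := by simpa [hs] using ⟨hab, hB⟩
      exact ⟨⟨s.min'_le a hb, s.le_max' a hb⟩, rfl⟩

theorem Clears.weaklyClears {S : List (Cut n m)} {B : Matrix (Fin n) (Fin m) ℕ} (h : Clears S B) :
    WeaklyClears S B := by
  induction S generalizing B with
  | nil => exact h
  | cons C S ih => exact ⟨h.1.2.2.2, ih h.2⟩

theorem WeaklyClears.exists_clears {S : List (Cut n m)} {B : Matrix (Fin n) (Fin m) ℕ}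
    (h : WeaklyClears S B) : ∃ S' : List (Cut n m), S'.length ≤ S.length ∧ Clears S' B := by
  induction S generalizing B with
  | nil => exact ⟨[], le_rfl, h⟩
  | cons C S ih =>
    obtain ⟨S', hS', hc⟩ := ih h.2
    by_cases hC : ∃ p ∈ C.cells, B p.1 p.2 ≠ 0
    · obtain ⟨D, hD, hle, h₁, h₂, hp⟩ := C.exists_trimmed hC
      have : D.apply B = C.apply B := by
        ext i j
        by_cases hi : (i, j) ∈ D.cells
        · rw [Cut.apply_of_mem hi, Cut.apply_of_mem (hD hi)]
        · rw [Cut.apply_of_notMem hi]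
          by_cases hi' : (i, j) ∈ C.cells
          · rw [Cut.apply_of_mem hi']
            by_contra hB
            exact hi (hp _ hi' hB)
          · rw [Cut.apply_of_notMem hi']
      refine ⟨D :: S', by simpa using hS', ⟨hle, h₁, h₂, fun p hp q hq =>
        h.1 p (hD hp) q (hD hq)⟩, ?_⟩
      rwa [this]
    · push Not at hC
      have : C.apply B = B := by
        ext i j
        by_cases hi : (i, j) ∈ C.cells
        · rw [Cut.apply_of_mem hi, hC _ hi]
        · rw [Cut.apply_of_notMem hi]
      rw [this] at hc
      exact ⟨S', by simp; omega, hc⟩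

/-! ### Symmetry and monotonicity -/

/-- The segment reflected at the main diagonal. -/
def Cut.transpose : Cut n m → Cut m n
  | .horizontal i j₁ j₂ => .vertical j₁ j₂ i
  | .vertical i₁ i₂ j => .horizontal j i₁ i₂

theorem Cut.mem_cells_transpose {C : Cut n m} {i : Fin n} {j : Fin m} :
    (j, i) ∈ C.transpose.cells ↔ (i, j) ∈ C.cells := by
  cases C <;> simp [Cut.transpose, and_comm]

theorem Clears.transpose {S : List (Cut n m)} {B : Matrix (Fin n) (Fin m) ℕ} (h : Clears S B) :
    Clears (S.map Cut.transpose) B.transpose := by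
  induction S generalizing B with
  | nil => simp only [Clears] at h; simp [Clears, h]
  | cons C S ih =>
    refine ⟨⟨?_, ?_, ?_, fun p hp q hq => ?_⟩, ?_⟩
    · have := h.1.1
      cases C <;> exact ⟨this.2, this.1⟩
    · have := h.1.2.1
      cases C <;> exact this
    · have := h.1.2.2.1
      cases C <;> exact this
    · exact h.1.2.2.2 (p.2, p.1) (Cut.mem_cells_transpose.1 hp) (q.2, q.1)
        (Cut.mem_cells_transpose.1 hq)
    · have : C.transpose.apply B.transpose = (C.apply B).transpose := by
        ext j i
        simp [Cut.apply, Cut.mem_cells_transpose]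
      rw [this]
      exact ih h.2

theorem Solvable.transpose {B : Matrix (Fin n) (Fin m) ℕ} {k : ℕ} (h : Solvable B k) :
    Solvable B.transpose k := by
  obtain ⟨S, hS, hc⟩ := h
  exact ⟨S.map Cut.transpose, by simpa using hS, hc.transpose⟩

theorem solvable_transpose {B : Matrix (Fin n) (Fin m) ℕ} {k : ℕ} :
    Solvable B.transpose k ↔ Solvable B k :=
  ⟨fun h => by simpa using h.transpose, Solvable.transpose⟩

/-- Deleting buttons preserves solvability: the same segments still clear the grid, and can be
trimmed. -/
theorem Solvable.of_sub {B B' : Matrix (Fin n) (Fin m) ℕ} {k : ℕ} (h : Solvable B k)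
    (hB : ∀ i j, B' i j = B i j ∨ B' i j = 0) : Solvable B' k := by
  obtain ⟨S, hS, hc⟩ := h
  suffices WeaklyClears S B' by
    obtain ⟨S', hS', hc'⟩ := this.exists_clears
    exact ⟨S', hS'.trans hS, hc'⟩
  replace hc := hc.weaklyClears
  clear hS
  induction S generalizing B B' with
  | nil =>
    simp only [WeaklyClears] at hc ⊢
    ext i j
    have := hB i j
    simpa [hc] using this
  | cons C S ih =>
    refine ⟨fun p hp q hq h₁ h₂ => ?_, ih (fun i j => ?_) hc.2⟩
    · have e₁ := (hB p.1 p.2).resolve_right h₁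
      have e₂ := (hB q.1 q.2).resolve_right h₂
      rw [e₁, e₂]
      exact hc.1 p hp q hq (e₁ ▸ h₁) (e₂ ▸ h₂)
    · by_cases hi : (i, j) ∈ C.cells
      · exact .inr (Cut.apply_of_mem hi)
      · rw [Cut.apply_of_notMem hi, Cut.apply_of_notMem hi]
        exact hB i j

/-! ### Twin columns -/

/-- The column `j` lies between the columns `c` and `c'`, in one order or the other. -/
def Between {m : ℕ} (c c' j : Fin m) : Prop := c ≤ j ∧ j ≤ c' ∨ c' ≤ j ∧ j ≤ c

/-- The columns `c` and `c'` are equal, and every row with a button in them has only buttons of the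
same colour between them. -/
def Twin (B : Matrix (Fin n) (Fin m) ℕ) (c c' : Fin m) : Prop :=
  ∀ r, B r c = B r c' ∧ (B r c ≠ 0 → ∀ j, Between c c' j → B r j ≠ 0 → B r j = B r c)

/-- The grid in which column `c` is emptied. -/
def zeroCol (c : Fin m) (B : Matrix (Fin n) (Fin m) ℕ) : Matrix (Fin n) (Fin m) ℕ :=
  fun i j => if j = c then 0 else B i j

/-- If `S` clears `G` and does not contain a vertical cut in the column `c'`, then it can be adapted
to a grid `G'` with further buttons in column `c`, provided that `c` is a twin of `c'` in the
original grid `B` and that `(r, c)` contains a button only as long as `(r, c')` does: each cut which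
removes `(r, c')` is extended to `(r, c)`. -/
theorem exists_weaklyClears_of_twin {B : Matrix (Fin n) (Fin m) ℕ} {c c' : Fin m}
    (ht : Twin B c c') {S : List (Cut n m)} (hS : ∀ i₁ i₂, Cut.vertical i₁ i₂ c' ∉ S)
    {G G' : Matrix (Fin n) (Fin m) ℕ} (hG : Clears S G)
    (h₀ : ∀ i, G i c = 0) (hB : ∀ i j, G i j ≠ 0 → G i j = B i j)
    (hG' : ∀ i j, j ≠ c → G' i j ≠ 0 → G' i j = G i j)
    (hc : ∀ i, G' i c ≠ 0 → G' i c = B i c ∧ G i c' ≠ 0) :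
    ∃ S' : List (Cut n m), S'.length = S.length ∧ WeaklyClears S' G' := by
  induction S generalizing G G' with
  | nil =>
    refine ⟨[], rfl, ?_⟩
    simp only [Clears] at hG
    ext i j
    by_contra hne
    by_cases hj : j = c
    · subst hj
      exact (hc i hne).2 (by simp [hG])
    · exact hne (by rw [hG' i j hj hne, hG])
  | cons C S ih =>
    obtain ⟨⟨hle, hf, hl, hmono⟩, hG⟩ := hG
    -- Every segment that removes at least the same buttons outside column `c` may replace `C`.
    have key : ∀ D : Cut n m, D.IsMono G' → (∀ p ∈ C.cells, p.2 ≠ c → p ∈ D.cells) →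
        (∀ i, G i c' ≠ 0 → (i, c') ∈ C.cells → G' i c ≠ 0 → (i, c) ∈ D.cells) →
        ∃ S' : List (Cut n m), S'.length = (C :: S).length ∧ WeaklyClears S' G' := by
      intro D hD hCD hc'
      obtain ⟨S', hlen, hw⟩ := ih (fun i₁ i₂ hi => hS i₁ i₂ (List.mem_cons_of_mem _ hi)) hG
        (G' := D.apply G')
        (fun i => by rcases C.apply_eq_or G i c with h | h <;> simp [h, h₀])
        (fun i j h => by
          rcases C.apply_eq_or G i j with h' | h'
          · rw [h'] at h ⊢; exact hB i j h
          · exact absurd h' h)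
        (fun i j hj h => by
          have hn : (i, j) ∉ D.cells := fun hm => h (Cut.apply_of_mem hm)
          rw [Cut.apply_of_notMem hn] at h ⊢
          rw [Cut.apply_of_notMem fun hm => hn (hCD _ hm hj)]
          exact hG' i j hj h)
        (fun i h => by
          have hn : (i, c) ∉ D.cells := fun hm => h (Cut.apply_of_mem hm)
          rw [Cut.apply_of_notMem hn] at h ⊢
          obtain ⟨h₁, h₂⟩ := hc i h
          refine ⟨h₁, ?_⟩
          rw [Cut.apply_of_notMem fun hm => hn (hc' i h₂ hm h)]
          exact h₂)
      exact ⟨D :: S', by simp [hlen], hD, hw⟩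
    -- A button of column `c` has the colour of all the buttons between `c` and `c'`.
    have hcol : ∀ i j, G' i c ≠ 0 → Between c c' j → G i j ≠ 0 → G i j = G' i c := by
      intro i j h hj hne
      rw [(hc i h).1, hB i j hne]
      exact (ht i).2 ((hc i h).1 ▸ h) j hj (hB i j hne ▸ hne)
    cases C with
    | vertical i₁ i₂ j =>
      have hjc : j ≠ c := by rintro rfl; exact hf (h₀ _)
      have hjc' : j ≠ c' := by rintro rfl; exact hS _ _ List.mem_cons_self
      refine key (.vertical i₁ i₂ j) ?_ (fun p hp _ => hp) ?_
      · intro p hp q hq h₁ h₂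
        have hp' := (Cut.mem_cells_vertical.1 hp).2
        have hq' := (Cut.mem_cells_vertical.1 hq).2
        have e₁ := hG' p.1 p.2 (hp' ▸ hjc) h₁
        have e₂ := hG' q.1 q.2 (hq' ▸ hjc) h₂
        rw [e₁, e₂]
        exact hmono p hp q hq (e₁ ▸ h₁) (e₂ ▸ h₂)
      · intro i _ hm
        exact absurd (Cut.mem_cells_vertical.1 hm).2.symm hjc'
    | horizontal i j₁ j₂ =>
      -- It suffices that a button of column `c` in the new segment has the colour of some button
      -- that `C` removes.
      have hm : ∀ l₁ l₂ : Fin m, (∀ j, l₁ ≤ j → j ≤ l₂ → j ≠ c → G' i j ≠ 0 →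
            ∃ j', (j₁ ≤ j' ∧ j' ≤ j₂) ∧ G i j' ≠ 0 ∧ G' i j = G i j') →
          (l₁ ≤ c → c ≤ l₂ → G' i c ≠ 0 →
            ∃ j', (j₁ ≤ j' ∧ j' ≤ j₂) ∧ G i j' ≠ 0 ∧ G' i c = G i j') →
          (Cut.horizontal i l₁ l₂).IsMono G' := by
        rintro l₁ l₂ h₁ h₂ ⟨a, b⟩ hp ⟨a', b'⟩ hq hne hne'
        obtain ⟨rfl, hb₁, hb₂⟩ := Cut.mem_cells_horizontal.1 hp
        obtain ⟨ha, hb'₁, hb'₂⟩ := Cut.mem_cells_horizontal.1 hq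
        obtain rfl : a' = a := ha
        have h : ∀ b, l₁ ≤ b → b ≤ l₂ → G' a' b ≠ 0 →
            ∃ j', (j₁ ≤ j' ∧ j' ≤ j₂) ∧ G a' j' ≠ 0 ∧ G' a' b = G a' j' := by
          intro b hb₁ hb₂ hne
          by_cases hbc : b = c
          · subst hbc; exact h₂ hb₁ hb₂ hne
          · exact h₁ b hb₁ hb₂ hbc hne
        obtain ⟨x, hx, hx0, e₁⟩ := h b hb₁ hb₂ hne
        obtain ⟨y, hy, hy0, e₂⟩ := h b' hb'₁ hb'₂ hne'
        rw [e₁, e₂]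
        exact hmono (a', x) (by simpa using hx) (a', y) (by simpa using hy) hx0 hy0
      by_cases hext : (j₁ ≤ c' ∧ c' ≤ j₂) ∧ G i c' ≠ 0 ∧ G' i c ≠ 0
      · obtain ⟨hcc, hGc', hGc⟩ := hext
        refine key (.horizontal i (min j₁ c) (max j₂ c)) (hm _ _ ?_ ?_) ?_ ?_
        · intro j hj₁ hj₂ hjc hne
          have e := hG' i j hjc hne
          by_cases hj : j₁ ≤ j ∧ j ≤ j₂
          · exact ⟨j, hj, e ▸ hne, e⟩
          · refine ⟨c', hcc, hGc', ?_⟩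
            rw [e, hcol i c' hGc (by unfold Between; omega) hGc']
            refine hcol i j hGc ?_ (e ▸ hne)
            simp only [min_le_iff, le_max_iff] at hj₁ hj₂
            unfold Between
            omega
        · intro _ _ _
          exact ⟨c', hcc, hGc', (hcol i c' hGc (by unfold Between; omega) hGc').symm⟩
        · intro p hp _
          obtain ⟨h₁, h₂, h₃⟩ := Cut.mem_cells_horizontal.1 hp
          exact Cut.mem_cells_horizontal.2 ⟨h₁, (min_le_left _ _).trans h₂,
            h₃.trans (le_max_left _ _)⟩
        · intro a _ ha _
          obtain ⟨h₁, -⟩ := Cut.mem_cells_horizontal.1 ha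
          exact Cut.mem_cells_horizontal.2 ⟨h₁, min_le_right _ _, le_max_right _ _⟩
      · refine key (.horizontal i j₁ j₂) (hm _ _ ?_ ?_) (fun p hp _ => hp) ?_
        · intro j hj₁ hj₂ hjc hne
          have e := hG' i j hjc hne
          exact ⟨j, ⟨hj₁, hj₂⟩, e ▸ hne, e⟩
        · -- Here `C` reaches over `c` without reaching `c'`, so that one of its ends is a button
          -- between the two.
          intro h₁ h₂ hne
          have hle' : j₁ ≤ j₂ := hle.2
          have hf' : G i j₁ ≠ 0 := hf
          have hl' : G i j₂ ≠ 0 := hl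
          have hn := (hc i hne).2
          have hout : c' < j₁ ∨ j₂ < c' := by
            by_contra hcon
            push Not at hcon
            exact hext ⟨hcon, hn, hne⟩
          rcases hout with h | h
          · exact ⟨j₁, ⟨le_rfl, hle'⟩, hf',
              (hcol i j₁ hne (by unfold Between; omega) hf').symm⟩
          · exact ⟨j₂, ⟨hle', le_rfl⟩, hl',
              (hcol i j₂ hne (by unfold Between; omega) hl').symm⟩
        · intro a hn ha hne
          obtain ⟨h₁, h₂⟩ := Cut.mem_cells_horizontal.1 ha
          dsimp only at h₁ h₂
          subst h₁
          exact absurd ⟨h₂, hn, hne⟩ hext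

open Classical in
/-- Emptying a column with more than `k` twins does not matter. -/
theorem solvable_zeroCol {B : Matrix (Fin n) (Fin m) ℕ} {k : ℕ} {c : Fin m}
    (hk : k < (Finset.univ.filter fun c' => c' ≠ c ∧ Twin B c c').card) :
    Solvable (zeroCol c B) k ↔ Solvable B k := by
  refine ⟨fun ⟨S, hS, hc⟩ => ?_, fun h => h.of_sub fun i j => ?_⟩
  · -- Some twin `c'` meets no vertical cut, since there are at most `k` of these.
    obtain ⟨c', hc', hv⟩ : ∃ c' ∈ Finset.univ.filter fun c' => c' ≠ c ∧ Twin B c c',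
        ∀ i₁ i₂, Cut.vertical i₁ i₂ c' ∉ S := by
      by_contra hcon
      push Not at hcon
      have hsub : (Finset.univ.filter fun c' => c' ≠ c ∧ Twin B c c') ⊆
          (S.map fun C => C.first.2).toFinset := by
        intro c' hc'
        obtain ⟨i₁, i₂, h⟩ := hcon c' hc'
        rw [List.mem_toFinset, List.mem_map]
        exact ⟨_, h, rfl⟩
      have h₁ := Finset.card_le_card hsub
      have h₂ := List.toFinset_card_le (S.map fun C => C.first.2)
      rw [List.length_map] at h₂
      omega
    rw [Finset.mem_filter] at hc'
    obtain ⟨-, hne, ht⟩ := hc'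
    obtain ⟨S', hlen, hw⟩ := exists_weaklyClears_of_twin ht hv hc (G' := B)
      (fun i => by simp [zeroCol]) (fun i j h => by
        by_cases hj : j = c
        · simp [zeroCol, hj] at h
        · simp [zeroCol, hj])
      (fun i j hj _ => by simp [zeroCol, hj])
      (fun i h => ⟨rfl, by simpa [zeroCol, hne, ← (ht i).1] using h⟩)
    obtain ⟨S'', hlen', hc''⟩ := hw.exists_clears
    exact ⟨S'', by omega, hc''⟩
  · by_cases hj : j = c <;> simp [zeroCol, hj]

/-! ### The number of classes of twins -/

/-- The two places between columns (a number `b` stands for the place left of column `b`) at which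
the pattern of the cuts may change because of the given cut. -/
def Cut.breaks : Cut n m → List ℕ
  | .horizontal _ j₁ j₂ => [j₁, j₂ + 1]
  | .vertical _ _ j => [j, j + 1]

theorem Cut.length_breaks (C : Cut n m) : C.breaks.length = 2 := by cases C <;> rfl

/-- The zone of a column: the number of breaks to the left of it. -/
def zone (S : List (Cut n m)) (c : ℕ) : ℕ := (S.flatMap Cut.breaks).countP fun b => b ≤ c

theorem zone_lt (S : List (Cut n m)) (c : ℕ) : zone S c < 2 * S.length + 1 := by
  have h : zone S c ≤ (S.flatMap Cut.breaks).length := List.countP_le_length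
  have : (S.flatMap Cut.breaks).length = 2 * S.length := by
    induction S with
    | nil => rfl
    | cons C S ih =>
      have := C.length_breaks
      simp only [List.flatMap_cons, List.length_append, List.length_cons]
      have := ih List.countP_le_length
      omega
  omega

theorem notMem_breaks_of_zone_eq {S : List (Cut n m)} {c c' : ℕ}
    (h : zone S c = zone S c') {C : Cut n m} (hC : C ∈ S) {b : ℕ} (hb : b ∈ C.breaks) :
    ¬ (c < b ∧ b ≤ c') := by
  rintro ⟨h₁, h₂⟩
  have hb : b ∈ S.flatMap Cut.breaks := List.mem_flatMap.2 ⟨C, hC, hb⟩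
  unfold zone at h
  obtain ⟨l₁, l₂, hl⟩ := List.append_of_mem hb
  rw [hl] at h
  have e₁ : l₁.countP (fun b => decide (b ≤ c)) ≤ l₁.countP (fun b => decide (b ≤ c')) :=
    List.countP_mono_left (by simp; intros; omega)
  have e₂ : l₂.countP (fun b => decide (b ≤ c)) ≤ l₂.countP (fun b => decide (b ≤ c')) :=
    List.countP_mono_left (by simp; intros; omega)
  simp [List.countP_append, h₂, show ¬ b ≤ c by omega] at h
  omega

/-- Between two columns of the same zone, every row contains buttons of at most one colour; and if
the columns are different then every nonempty row contains a horizontal cut. -/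
theorem Clears.eq_of_no_break {S : List (Cut n m)} {B : Matrix (Fin n) (Fin m) ℕ}
    (hS : Clears S B) {c c' : Fin m} (hlt : c < c')
    (hb : ∀ C ∈ S, ∀ b ∈ C.breaks, ¬ ((c : ℕ) < b ∧ b ≤ (c' : ℕ))) {r : Fin n} {j : Fin m}
    (hj : c ≤ j ∧ j ≤ c') (hne : B r j ≠ 0) :
    (∃ j₁ j₂, Cut.horizontal r j₁ j₂ ∈ S) ∧
      ∀ j', c ≤ j' ∧ j' ≤ c' → B r j' ≠ 0 → B r j = B r j' := by
  induction S generalizing B with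
  | nil => simp only [Clears] at hS; simp [hS] at hne
  | cons C S ih =>
    have hbC := hb C List.mem_cons_self
    by_cases hC : ∃ x, (c ≤ x ∧ x ≤ c') ∧ (r, x) ∈ C.cells
    · obtain ⟨x, hx, hxC⟩ := hC
      cases C with
      | vertical i₁ i₂ y =>
        obtain ⟨-, rfl⟩ := Cut.mem_cells_vertical.1 hxC
        dsimp only at *
        have h₁ := hbC x (by simp [Cut.breaks])
        have h₂ := hbC (x + 1) (by simp [Cut.breaks])
        omega
      | horizontal i j₁ j₂ =>
        obtain ⟨rfl, h₁, h₂⟩ := Cut.mem_cells_horizontal.1 hxC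
        dsimp only at *
        have h₃ := hbC j₁ (by simp [Cut.breaks])
        have h₄ := hbC (j₂ + 1) (by simp [Cut.breaks])
        refine ⟨⟨j₁, j₂, List.mem_cons_self⟩, fun j' hj' hne' => ?_⟩
        exact hS.1.2.2.2 (r, j) (by rw [Cut.mem_cells_horizontal]; simp; omega) (r, j')
          (by rw [Cut.mem_cells_horizontal]; simp; omega) hne hne'
    · have hun : ∀ x, c ≤ x ∧ x ≤ c' → C.apply B r x = B r x := fun x hx =>
        Cut.apply_of_notMem fun hm => hC ⟨x, hx, hm⟩
      obtain ⟨⟨j₁, j₂, hm⟩, h⟩ := ih hS.2 (fun C hC => hb C (List.mem_cons_of_mem _ hC))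
        (by rwa [hun j hj])
      refine ⟨⟨j₁, j₂, List.mem_cons_of_mem _ hm⟩, fun j' hj' hne' => ?_⟩
      rw [← hun j hj, ← hun j' hj']
      exact h j' hj' (by rwa [hun j' hj'])

/-- The rows that contain one of the given segments or start a vertical one. -/
def cutRows (S : List (Cut n m)) : Finset (Fin n) := (S.map fun C => C.first.1).toFinset

/-- Two columns in the same zone with buttons in the same of the rows that meet horizontal cuts are
twins. -/
theorem Clears.twin {S : List (Cut n m)} {B : Matrix (Fin n) (Fin m) ℕ} (hS : Clears S B)
    {c c' : Fin m} (hz : zone S c = zone S c')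
    (hp : ∀ r ∈ cutRows S, B r c ≠ 0 ↔ B r c' ≠ 0) : Twin B c c' := by
  have key : ∀ {c c' : Fin m}, c < c' → zone S c = zone S c' →
      (∀ r ∈ cutRows S, B r c ≠ 0 ↔ B r c' ≠ 0) → ∀ r,
      B r c = B r c' ∧ ∀ j j', c ≤ j ∧ j ≤ c' → c ≤ j' ∧ j' ≤ c' → B r j ≠ 0 → B r j' ≠ 0 →
        B r j = B r j' := by
    intro c c' hlt hz hp r
    have h := fun (j : Fin m) (hj : c ≤ j ∧ j ≤ c') (hne : B r j ≠ 0) =>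
      hS.eq_of_no_break hlt
        (fun C hC b hb => notMem_breaks_of_zone_eq hz hC hb) (r := r) hj hne
    refine ⟨?_, fun j j' hj hj' hne hne' => (h j hj hne).2 j' hj' hne'⟩
    have hrow : ∀ j, c ≤ j ∧ j ≤ c' → B r j ≠ 0 → r ∈ cutRows S := by
      intro j hj hne
      obtain ⟨⟨j₁, j₂, hm⟩, -⟩ := h j hj hne
      rw [cutRows, List.mem_toFinset, List.mem_map]
      exact ⟨_, hm, rfl⟩
    by_cases hc : B r c = 0
    · by_contra hne
      have hne' : B r c' ≠ 0 := fun h => hne (by rw [hc, h])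
      exact (hp r (hrow c' ⟨hlt.le, le_rfl⟩ hne')).2 hne' hc
    · exact (h c ⟨le_rfl, hlt.le⟩ hc).2 c' ⟨hlt.le, le_rfl⟩
        ((hp r (hrow c ⟨le_rfl, hlt.le⟩ hc)).1 hc)
  rcases lt_trichotomy c c' with hlt | rfl | hlt
  · intro r
    obtain ⟨h₁, h₂⟩ := key hlt hz hp r
    exact ⟨h₁, fun hne j hj hj' => h₂ j c (by unfold Between at hj; omega)
      ⟨le_rfl, hlt.le⟩ hj' hne⟩
  · intro r
    refine ⟨rfl, fun _ j hj _ => ?_⟩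
    obtain rfl : j = c := by unfold Between at hj; omega
    rfl
  · intro r
    obtain ⟨h₁, h₂⟩ := key hlt hz.symm (fun r hr => (hp r hr).symm) r
    exact ⟨h₁.symm, fun hne j hj hj' => h₂ j c (by unfold Between at hj; omega)
      ⟨hlt.le, le_rfl⟩ hj' hne⟩

/-! ### Emptying the superfluous columns -/

open Classical in
/-- Column `c` is emptied if it has more than `k` twins. -/
noncomputable def pruneCol (k : ℕ) (c : Fin m) (B : Matrix (Fin n) (Fin m) ℕ) : Matrix (Fin n) (Fin m) ℕ :=
  if k < (Finset.univ.filter fun c' => c' ≠ c ∧ Twin B c c').card then zeroCol c B else B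

/-- The first `l` columns are pruned, one after the other. -/
noncomputable def pruneCols (k : ℕ) (B : Matrix (Fin n) (Fin m) ℕ) : ℕ → Matrix (Fin n) (Fin m) ℕ
  | 0 => B
  | l + 1 => if h : l < m then pruneCol k ⟨l, h⟩ (pruneCols k B l) else pruneCols k B l

theorem solvable_pruneCols {k : ℕ} {B : Matrix (Fin n) (Fin m) ℕ} (l : ℕ) :
    Solvable (pruneCols k B l) k ↔ Solvable B k := by
  induction l with
  | zero => rfl
  | succ l ih =>
    rw [pruneCols]
    split_ifs with h
    · unfold pruneCol
      split_ifs with h'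
      · rw [solvable_zeroCol h', ih]
      · exact ih
    · exact ih

/-- Pruning only empties columns. -/
theorem pruneCols_eq_or (k : ℕ) (B : Matrix (Fin n) (Fin m) ℕ) {l l' : ℕ} (hl : l ≤ l')
    (j : Fin m) : (∀ i, pruneCols k B l' i j = pruneCols k B l i j) ∨
      ∀ i, pruneCols k B l' i j = 0 := by
  induction l', hl using Nat.le_induction with
  | base => exact .inl fun _ => rfl
  | succ l' hl ih =>
    rw [pruneCols]
    split_ifs with h
    · unfold pruneCol
      split_ifs with h'
      · by_cases hj : j = ⟨l', h⟩
        · exact .inr fun i => by simp [zeroCol, hj]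
        · simpa [zeroCol, hj] using ih
      · exact ih
    · exact ih

/-- Twins that both survive remain twins, since pruning removes only obstacles between them. -/
theorem Twin.pruneCols {k l : ℕ} {B : Matrix (Fin n) (Fin m) ℕ} {c c' : Fin m} (h : Twin B c c')
    (hc : ∀ i, pruneCols k B l i c = B i c) (hc' : ∀ i, pruneCols k B l i c' = B i c') :
    Twin (pruneCols k B l) c c' := by
  intro r
  rw [hc, hc']
  refine ⟨(h r).1, fun hne j hj hj' => ?_⟩
  rcases pruneCols_eq_or k B (Nat.zero_le l) j with hr | hr
  · rw [hr r] at hj' ⊢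
    exact (h r).2 hne j hj hj'
  · exact absurd (hr r) hj'

open Classical in
/-- Among pairwise twins, at most `k + 1` survive. -/
theorem card_le_of_twin {k : ℕ} {B : Matrix (Fin n) (Fin m) ℕ} {s : Finset (Fin m)}
    (hs : ∀ c ∈ s, ∀ c' ∈ s, Twin B c c') (hne : ∀ c ∈ s, ∃ i, pruneCols k B m i c ≠ 0) :
    s.card ≤ k + 1 := by
  by_contra! hk
  have hun : ∀ l ≤ m, ∀ c ∈ s, ∀ i, pruneCols k B l i c = B i c := by
    intro l hl c hc
    refine (pruneCols_eq_or k B (Nat.zero_le l) c).resolve_right fun h₀ => ?_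
    obtain ⟨i, hi⟩ := hne c hc
    rcases pruneCols_eq_or k B hl c with h | h
    · exact hi (by rw [h, h₀])
    · exact hi (h i)
  obtain ⟨c, hc⟩ : s.Nonempty := Finset.card_pos.1 (by omega)
  -- When column `c` was considered, it still had all the other columns as twins.
  have hsub : s.erase c ⊆ Finset.univ.filter fun c' => c' ≠ c ∧
      Twin (pruneCols k B (c : ℕ)) c c' := by
    intro c' hc'
    rw [Finset.mem_erase] at hc'
    rw [Finset.mem_filter]
    exact ⟨Finset.mem_univ _, hc'.1, (hs c hc c' hc'.2).pruneCols (hun _ c.2.le c hc)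
      (hun _ c.2.le c' hc'.2)⟩
  have hcard := Finset.card_le_card hsub
  rw [Finset.card_erase_of_mem hc] at hcard
  obtain ⟨i, hi⟩ := hne c hc
  have hz : pruneCols k B (c + 1 : ℕ) i c = 0 := by
    rw [pruneCols, dif_pos c.2, pruneCol, if_pos (lt_of_lt_of_le (by omega) hcard)]
    simp [zeroCol]
  rcases pruneCols_eq_or k B (show (c : ℕ) + 1 ≤ m from c.2) c with h | h
  · exact hi (by rw [h, hz])
  · exact hi (h i)

/-- After pruning a yes-instance, few nonempty columns are left. -/
theorem card_nonempty_pruneCols_le {k : ℕ} {B : Matrix (Fin n) (Fin m) ℕ} (h : Solvable B k) :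
    (Finset.univ.filter fun c => ∃ i, pruneCols k B m i c ≠ 0).card ≤ 2 * 8 ^ k := by
  classical
  obtain ⟨S, hS, hc⟩ := h
  let f : Fin m → ℕ × Finset (Fin n) := fun c => (zone S c, (cutRows S).filter fun r => B r c ≠ 0)
  let t : Finset (ℕ × Finset (Fin n)) := Finset.range (2 * k + 1) ×ˢ (cutRows S).powerset
  have hf : ∀ c ∈ Finset.univ.filter (fun c => ∃ i, pruneCols k B m i c ≠ 0), f c ∈ t := by
    intro c _
    rw [Finset.mem_product, Finset.mem_range, Finset.mem_powerset]
    have := zone_lt S c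
    exact ⟨by simp only [f]; omega, Finset.filter_subset _ _⟩
  have hfib := Finset.card_le_mul_card_image_of_maps_to hf (k + 1) (fun y _ => by
    refine card_le_of_twin (B := B) (k := k) (fun c hc₁ c' hc₂ => ?_) (fun c hc₁ => ?_)
    · rw [Finset.mem_filter] at hc₁ hc₂
      have he := hc₁.2.trans hc₂.2.symm
      simp only [f, Prod.mk.injEq] at he
      refine hc.twin he.1 fun r hr => ?_
      have := congrArg (r ∈ ·) he.2
      simpa [hr] using this
    · rw [Finset.mem_filter, Finset.mem_filter] at hc₁
      exact hc₁.1.2)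
  have hrows : (cutRows S).card ≤ k := by
    refine (List.toFinset_card_le _).trans ?_
    rwa [List.length_map]
  have ht : t.card ≤ (2 * k + 1) * 2 ^ k := by
    rw [Finset.card_product, Finset.card_range, Finset.card_powerset]
    gcongr
    omega
  have hk : k + 1 ≤ 2 ^ k := Nat.lt_two_pow_self
  calc _ ≤ (k + 1) * t.card := hfib
    _ ≤ 2 ^ k * ((2 * 2 ^ k) * 2 ^ k) := by
      refine Nat.mul_le_mul hk (ht.trans (Nat.mul_le_mul_right _ (by omega)))
    _ = 2 * 8 ^ k := by
      rw [show (8 : ℕ) = 2 * 2 * 2 by norm_num, Nat.mul_pow, Nat.mul_pow]; ring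

/-- The columns are pruned, and then the rows. -/
noncomputable def pruned (k : ℕ) (B : Matrix (Fin n) (Fin m) ℕ) : Matrix (Fin n) (Fin m) ℕ :=
  (pruneCols k (pruneCols k B m).transpose n).transpose

theorem solvable_pruned {k : ℕ} {B : Matrix (Fin n) (Fin m) ℕ} :
    Solvable (pruned k B) k ↔ Solvable B k := by
  rw [pruned, solvable_transpose, solvable_pruneCols, solvable_transpose, solvable_pruneCols]

theorem numButtons_pruned_le {k : ℕ} {B : Matrix (Fin n) (Fin m) ℕ} (h : Solvable B k) :
    numButtons (pruned k B) ≤ 4 * 64 ^ k := by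
  have h₁ := card_nonempty_pruneCols_le h
  have h₂ := card_nonempty_pruneCols_le (solvable_transpose.2 ((solvable_pruneCols m).2 h))
  have hsub : (Finset.univ.filter fun p : Fin n × Fin m => pruned k B p.1 p.2 ≠ 0) ⊆
      (Finset.univ.filter fun r => ∃ i, pruneCols k (pruneCols k B m).transpose n i r ≠ 0) ×ˢ
      (Finset.univ.filter fun c => ∃ i, pruneCols k B m i c ≠ 0) := by
    rintro ⟨i, j⟩ hij
    rw [Finset.mem_filter] at hij
    have hij' : pruneCols k (pruneCols k B m).transpose n j i ≠ 0 := hij.2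
    simp only [Finset.mem_product, Finset.mem_filter, Finset.mem_univ, true_and]
    refine ⟨⟨j, hij'⟩, i, ?_⟩
    rcases pruneCols_eq_or k (pruneCols k B m).transpose (Nat.zero_le n) i with h | h
    · rw [h j] at hij'
      exact hij'
    · exact absurd (h j) hij'
  calc numButtons (pruned k B) ≤ _ := Finset.card_le_card hsub
    _ ≤ (2 * 8 ^ k) * (2 * 8 ^ k) := by
      rw [Finset.card_product]; exact Nat.mul_le_mul h₂ h₁
    _ = 4 * 64 ^ k := by
      rw [show (64 : ℕ) = 8 * 8 by norm_num, Nat.mul_pow]; ring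

/-! ### A small no-instance -/

/-- A grid whose first `k + 1` cells contain buttons of pairwise different colours. -/
def colourful (n m k : ℕ) : Matrix (Fin n) (Fin m) ℕ :=
  fun i j => if k < (i : ℕ) * m + j then 0 else (i : ℕ) * m + j + 1

/-- Every cut removes at most one colour. -/
theorem Clears.card_colours_le {S : List (Cut n m)} {B : Matrix (Fin n) (Fin m) ℕ}
    (h : Clears S B) {s : Finset ℕ} (hs : ∀ x ∈ s, x ≠ 0 ∧ ∃ i j, B i j = x) :
    s.card ≤ S.length := by
  induction S generalizing B s with
  | nil =>
    simp only [Clears] at h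
    rw [Finset.card_eq_zero.2]
    · exact Nat.zero_le _
    · refine Finset.eq_empty_of_forall_notMem fun x hx => ?_
      obtain ⟨h0, i, j, hB⟩ := hs x hx
      exact h0 (by rw [← hB, h]; rfl)
  | cons C S ih =>
    have h' := ih h.2 (s := s.erase (B C.first.1 C.first.2)) (fun x hx => by
      rw [Finset.mem_erase] at hx
      obtain ⟨h0, i, j, hB⟩ := hs x hx.2
      refine ⟨h0, i, j, ?_⟩
      rw [Cut.apply_of_notMem, hB]
      intro hm
      refine hx.1 ?_
      rw [← hB]
      refine h.1.2.2.2 (i, j) hm C.first ?_ (by simpa [hB] using h0) h.1.2.1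
      have hle := h.1.1
      cases C with
      | horizontal i j₁ j₂ => exact Cut.mem_cells_horizontal.2 ⟨rfl, le_rfl, hle.2⟩
      | vertical i₁ i₂ j => exact Cut.mem_cells_vertical.2 ⟨⟨le_rfl, hle.1⟩, rfl⟩)
    have := Finset.pred_card_le_card_erase (s := s) (a := B C.first.1 C.first.2)
    simp only [List.length_cons]
    omega

/-- The cells of a grid are numbered row by row. -/
theorem cell_lt (i : Fin n) (j : Fin m) : (i : ℕ) * m + j < n * m := by
  calc (i : ℕ) * m + j < i * m + m := by omega
    _ = (i + 1) * m := by ring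
    _ ≤ n * m := Nat.mul_le_mul_right _ i.2

theorem cell_inj {i i' : Fin n} {j j' : Fin m} (h : (i : ℕ) * m + j = i' * m + j') :
    i = i' ∧ j = j' := by
  have hm : 0 < m := j.pos
  have e₁ : (i : ℕ) = i' := by
    have := congrArg (· / m) h
    simpa [Nat.mul_comm _ m, Nat.mul_add_div hm, Nat.div_eq_of_lt] using this
  refine ⟨Fin.ext e₁, Fin.ext ?_⟩
  rw [e₁] at h
  omega

theorem exists_cell {p : ℕ} (h : p < n * m) : ∃ (i : Fin n) (j : Fin m), (i : ℕ) * m + j = p := by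
  have hm : 0 < m := Nat.pos_of_ne_zero fun h0 => by simp [h0] at h
  refine ⟨⟨p / m, Nat.div_lt_of_lt_mul (by rwa [Nat.mul_comm])⟩, ⟨p % m, Nat.mod_lt _ hm⟩, ?_⟩
  exact Nat.div_add_mod' p m

theorem not_solvable_colourful {k : ℕ} (h : k < n * m) : ¬ Solvable (colourful n m k) k := by
  rintro ⟨S, hS, hc⟩
  have := hc.card_colours_le (s := (Finset.range (k + 1)).image (· + 1)) (fun x hx => by
    rw [Finset.mem_image] at hx
    obtain ⟨p, hp, rfl⟩ := hx
    rw [Finset.mem_range] at hp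
    obtain ⟨i, j, hij⟩ := exists_cell (n := n) (m := m) (p := p) (by omega)
    exact ⟨by omega, i, j, by rw [colourful, hij, if_neg (by omega)]⟩)
  rw [Finset.card_image_of_injective _ (add_left_injective 1), Finset.card_range] at this
  omega

theorem numButtons_colourful_le (n m k : ℕ) : numButtons (colourful n m k) ≤ k + 1 := by
  rw [← Finset.card_range (k + 1)]
  refine Finset.card_le_card_of_injOn (fun p => (p.1 : ℕ) * m + p.2) (fun p hp => ?_)
    (fun p _ q _ h => ?_)
  · have hp := (Finset.mem_filter.1 hp).2
    simp only [colourful] at hp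
    simp only [Finset.coe_range, Set.mem_Iio]
    by_contra hcon
    exact hp (if_pos (by omega))
  · obtain ⟨h₁, h₂⟩ := cell_inj h
    exact Prod.ext h₁ h₂

theorem numButtons_le (B : Matrix (Fin n) (Fin m) ℕ) : numButtons B ≤ n * m := by
  refine (Finset.card_filter_le _ _).trans ?_
  simp

/-- The reduced instance: the pruned grid, or a small no-instance if the pruned grid contains too
many buttons for a yes-instance. -/
noncomputable def reduced (k : ℕ) (B : Matrix (Fin n) (Fin m) ℕ) : Matrix (Fin n) (Fin m) ℕ :=
  if 4 * 64 ^ k < numButtons (pruned k B) then colourful n m k else pruned k B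

theorem lt_four_mul_pow (k : ℕ) : k < 4 * 64 ^ k := by
  have : k < 64 ^ k := Nat.lt_pow_self (by norm_num)
  omega

/-- The small no-instance fits into the grid, which has more than `k` cells if it contains that many
buttons. -/
theorem solvable_reduced {k : ℕ} {B : Matrix (Fin n) (Fin m) ℕ} :
    Solvable (reduced k B) k ↔ Solvable B k := by
  unfold reduced
  split_ifs with h
  · have h₁ := numButtons_le (pruned k B)
    have h₂ := lt_four_mul_pow k
    refine iff_of_false (not_solvable_colourful (by omega)) fun hs => ?_
    have := numButtons_pruned_le hs
    omega
  · exact solvable_pruned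

theorem numButtons_reduced_le (k : ℕ) (B : Matrix (Fin n) (Fin m) ℕ) :
    numButtons (reduced k B) ≤ 4 * 64 ^ k := by
  unfold reduced
  split_ifs with h
  · have h₁ := numButtons_colourful_le n m k
    have h₂ := lt_four_mul_pow k
    omega
  · omega

end Combinatorics

/-! ### Formulas and loops over a grid -/

namespace SumExpr

/-- The formula holds: its value is not `0`. -/
def IsTrue (e : SumExpr) (σ : State) : Prop := e.eval σ ≠ 0

/-- Negation. -/
def not (e : SumExpr) : SumExpr := isEq e (lit 0)

/-- Conjunction. -/
def and (e₁ e₂ : SumExpr) : SumExpr := ite e₁ e₂ (lit 0)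

/-- Disjunction. -/
def or (e₁ e₂ : SumExpr) : SumExpr := ite e₁ (lit 1) e₂

/-- Implication. -/
def imp (e₁ e₂ : SumExpr) : SumExpr := ite e₁ e₂ (lit 1)

/-- The comparison `e₁ ≤ e₂`. -/
def le (e₁ e₂ : SumExpr) : SumExpr := not (isLt e₂ e₁)

/-- The quantifier `∀ x < b`, where `b` is a register. -/
def all (x b : ℕ) (e : SumExpr) : SumExpr := not (sum x b (not e))

/-- The quantifier `∃ x < b`, where `b` is a register. -/
def ex (x b : ℕ) (e : SumExpr) : SumExpr := sum x b e

theorem isTrue_isEq {e₁ e₂ : SumExpr} {σ : State} :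
    (isEq e₁ e₂).IsTrue σ ↔ e₁.eval σ = e₂.eval σ := by
  simp [IsTrue, eval]

theorem isTrue_isLt {e₁ e₂ : SumExpr} {σ : State} :
    (isLt e₁ e₂).IsTrue σ ↔ e₁.eval σ < e₂.eval σ := by
  simp [IsTrue, eval]

theorem isTrue_not {e : SumExpr} {σ : State} : e.not.IsTrue σ ↔ ¬ e.IsTrue σ := by
  by_cases h : e.eval σ = 0 <;> simp [not, IsTrue, eval, h]

theorem isTrue_and {e₁ e₂ : SumExpr} {σ : State} :
    (and e₁ e₂).IsTrue σ ↔ e₁.IsTrue σ ∧ e₂.IsTrue σ := by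
  by_cases h : e₁.eval σ = 0 <;> simp [and, IsTrue, eval, h]

theorem isTrue_or {e₁ e₂ : SumExpr} {σ : State} :
    (or e₁ e₂).IsTrue σ ↔ e₁.IsTrue σ ∨ e₂.IsTrue σ := by
  by_cases h : e₁.eval σ = 0 <;> simp [or, IsTrue, eval, h]

theorem isTrue_imp {e₁ e₂ : SumExpr} {σ : State} :
    (imp e₁ e₂).IsTrue σ ↔ (e₁.IsTrue σ → e₂.IsTrue σ) := by
  by_cases h : e₁.eval σ = 0 <;> simp [imp, IsTrue, eval, h]

theorem isTrue_le {e₁ e₂ : SumExpr} {σ : State} :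
    (le e₁ e₂).IsTrue σ ↔ e₁.eval σ ≤ e₂.eval σ := by
  rw [le, isTrue_not, isTrue_isLt, not_lt]

theorem isTrue_ex {x b N : ℕ} {e : SumExpr} {σ : State} (h : σ.var b = N) :
    (ex x b e).IsTrue σ ↔ ∃ i : Fin N, e.IsTrue (σ.setVar x i) := by
  simp [ex, IsTrue, eval, h, Fin.exists_iff]

theorem isTrue_all {x b N : ℕ} {e : SumExpr} {σ : State} (h : σ.var b = N) :
    (all x b e).IsTrue σ ↔ ∀ i : Fin N, e.IsTrue (σ.setVar x i) := by
  have := isTrue_ex (x := x) (e := e.not) h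
  rw [ex] at this
  rw [all, isTrue_not, this]
  simp [isTrue_not]

theorem eval_ite {e e₁ e₂ : SumExpr} {σ : State} [Decidable (e.IsTrue σ)] :
    (ite e e₁ e₂).eval σ = if e.IsTrue σ then e₁.eval σ else e₂.eval σ := by
  by_cases h : e.eval σ = 0 <;> simp [IsTrue, eval, h]

/-- The number of the cell in the row `var i` and the column `var j`. -/
def idx (i j : ℕ) : SumExpr :=
  add (sum 7 0 (ite (isLt (var 7) (var i)) (var 1) (lit 0))) (var j)

theorem eval_idx {i j : ℕ} {σ : State} (hi : i ≠ 7) (h : σ.var i < σ.var 0) :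
    (idx i j).eval σ = σ.var i * σ.var 1 + σ.var j := by
  have : (Finset.range (σ.var 0)).filter (fun x => x < σ.var i) = Finset.range (σ.var i) := by
    ext x; simp; omega
  simp [idx, eval, hi, ← Finset.sum_filter, this]

/-- The number of cells. -/
def area : SumExpr := sum 7 0 (var 1)

theorem eval_area (σ : State) : area.eval σ = σ.var 0 * σ.var 1 := by
  simp [area, eval]

/-- Twice the expression. -/
def double (e : SumExpr) : SumExpr := add e e

theorem eval_double (e : SumExpr) (σ : State) : e.double.eval σ = 2 * e.eval σ := by
  simp [double, eval]; omega

end SumExpr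

/-- The memories agree except for array `a` and the registers `13` and `14`. -/
structure Near (a : ℕ) (σ τ : State) : Prop where
  var : ∀ y, y ≠ 13 → y ≠ 14 → τ.var y = σ.var y
  arr : ∀ a', a' ≠ a → τ.arr a' = σ.arr a'

/-- The loop over all cells `(var 13, var 14)` of the grid that starts at the position `base` in
array `a`; it stores the value of `e` in the cell. -/
def mapGrid (a : ℕ) (base e : SumExpr) : Stmt :=
  .iterate 13 0 (.iterate 14 1 (.store a (.add base (.idx 13 14)) e))

/-- The meaning of `mapGrid`. The value `V i j` may depend on the old contents of array `a`, as far
as they have not been overwritten when the cell `(i, j)` is reached. -/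
theorem den_mapGrid {a b n m : ℕ} {base e : SumExpr} {σ : State} (h0 : σ.var 0 = n)
    (h1 : σ.var 1 = m) (V : Fin n → Fin m → ℕ) (hbase : ∀ τ, Near a σ τ → base.eval τ = b)
    (he : ∀ (τ : State) (i : Fin n) (j : Fin m), Near a σ τ → τ.var 13 = i → τ.var 14 = j →
      (∀ p, p < b ∨ b + (i * m + j) ≤ p → τ.arr a p = σ.arr a p) → e.eval τ = V i j) :
    Near a σ ((mapGrid a base e).den σ) ∧
      (∀ p, p < b ∨ b + n * m ≤ p → ((mapGrid a base e).den σ).arr a p = σ.arr a p) ∧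
      ∀ (i : Fin n) (j : Fin m), ((mapGrid a base e).den σ).arr a (b + (i * m + j)) = V i j := by
  -- The situation when the first `r` cells have been written.
  let W : ℕ → State → Prop := fun r τ => Near a σ τ ∧
    (∀ p, p < b ∨ b + r ≤ p → τ.arr a p = σ.arr a p) ∧
    ∀ (i : Fin n) (j : Fin m), (i : ℕ) * m + j < r → τ.arr a (b + (i * m + j)) = V i j
  have hW : ∀ r τ x v, x = 13 ∨ x = 14 → W r τ → W r (τ.setVar x v) := by
    rintro r τ x v hx ⟨h₁, h₂, h₃⟩
    refine ⟨⟨fun y hy hy' => ?_, h₁.arr⟩, h₂, h₃⟩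
    rw [State.setVar_var, if_neg (by omega)]
    exact h₁.var y hy hy'
  have key : W (n * m) ((mapGrid a base e).den σ) := by
    refine Stmt.den_iterate (fun i τ => W (i * m) τ) h0 ?_ ?_
    · refine hW _ _ _ _ (.inl rfl) ⟨⟨fun _ _ _ => rfl, fun _ _ => rfl⟩, fun _ _ => rfl, ?_⟩
      intro i j h
      simp at h
    · intro i hi τ hτ hτi
      refine hW _ _ _ _ (.inl rfl) ?_
      have hτ1 : τ.var 1 = m := by rw [hτ.1.var 1 (by omega) (by omega), h1]
      rw [show (i + 1) * m = i * m + m by ring]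
      refine (Stmt.den_iterate (fun j τ => W (i * m + j) τ ∧ τ.var 13 = i) hτ1 ?_ ?_).1
      · exact ⟨hW _ _ _ _ (.inr rfl) hτ, by simp [hτi]⟩
      · rintro j hj ρ ⟨hρ, hρi⟩ hρj
        refine ⟨hW _ _ _ _ (.inr rfl) ?_, by simp [Stmt.den, hρi]⟩
        obtain ⟨h₁, h₂, h₃⟩ := hρ
        have hidx : (SumExpr.add base (.idx 13 14)).eval ρ = b + (i * m + j) := by
          rw [SumExpr.eval, hbase ρ h₁, SumExpr.eval_idx (by omega)
            (by rw [hρi, h₁.var 0 (by omega) (by omega), h0]; exact hi), hρi, hρj,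
            h₁.var 1 (by omega) (by omega), h1]
        have hval : e.eval ρ = V ⟨i, hi⟩ ⟨j, hj⟩ := he ρ ⟨i, hi⟩ ⟨j, hj⟩ h₁ hρi hρj h₂
        refine ⟨⟨h₁.var, fun a' ha => ?_⟩, fun p hp => ?_, fun i' j' hij => ?_⟩
        · rw [← h₁.arr a' ha]
          ext p
          rw [Stmt.den, State.setArr_arr, if_neg (by tauto)]
        · rw [Stmt.den, hidx, State.setArr_arr, if_neg (by omega)]
          exact h₂ p (by omega)
        · rw [Stmt.den, hidx, State.setArr_arr]
          by_cases heq : (i' : ℕ) * m + j' = i * m + j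
          · obtain ⟨rfl, rfl⟩ := cell_inj (i := i') (i' := ⟨i, hi⟩) (j := j') (j' := ⟨j, hj⟩) heq
            rw [if_pos ⟨rfl, rfl⟩, hval]
          · rw [if_neg (by omega)]
            exact h₃ i' j' (by omega)
  exact ⟨key.1, key.2.1, fun i j => key.2.2 i j (cell_lt i j)⟩

/-! ### The program that reduces an instance -/

/-- The expressions `cell x y` yield the entries of the matrix `B` for row `var x` and column
`var y`. -/
def Reads (cell : ℕ → ℕ → SumExpr) {N M : ℕ} (B : Matrix (Fin N) (Fin M) ℕ) (σ : State) : Prop :=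
  ∀ τ : State, τ.arr 0 = σ.arr 0 → (∀ y < 3, τ.var y = σ.var y) → ∀ x y, x ≠ 7 → y ≠ 7 →
    ∀ (i : Fin N) (j : Fin M), τ.var x = i → τ.var y = j → (cell x y).eval τ = B i j

/-- The entry of the grid in row `var i` and column `var j`. -/
def entry (i j : ℕ) : SumExpr := .get 0 (.idx i j)

theorem reads_entry {n m k : ℕ} {B : Matrix (Fin n) (Fin m) ℕ} {σ : State} (h : σ.Holds B k) :
    Reads entry B σ := by
  intro τ ha hv x y hx _ i j hi hj
  obtain ⟨h0, h1, -, hB⟩ := h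
  rw [entry, SumExpr.eval, SumExpr.eval_idx hx (by rw [hi, hv 0 (by omega), h0]; exact i.2), hi, hj,
    hv 1 (by omega), h1, ha, hB]

theorem reads_entry_transpose {n m k : ℕ} {B : Matrix (Fin n) (Fin m) ℕ} {σ : State}
    (h : σ.Holds B k) : Reads (fun x y => entry y x) B.transpose σ :=
  fun τ ha hv x y hx hy i j hi hj => reads_entry h τ ha hv y x hy hx j i hj hi

/-- The column `var 3` is a twin of the column `var 4`. -/
def twinExpr (cell : ℕ → ℕ → SumExpr) (rb cb : ℕ) : SumExpr :=
  .all 5 rb (.and (.isEq (cell 5 3) (cell 5 4)) (.imp (cell 5 3) (.all 6 cb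
    (.imp (.or (.and (.le (.var 3) (.var 6)) (.le (.var 6) (.var 4)))
      (.and (.le (.var 4) (.var 6)) (.le (.var 6) (.var 3))))
      (.imp (cell 5 6) (.isEq (cell 5 6) (cell 5 3)))))))

theorem isTrue_twinExpr {cell : ℕ → ℕ → SumExpr} {rb cb N M : ℕ} {B : Matrix (Fin N) (Fin M) ℕ}
    {σ : State} (hcell : Reads cell B σ) (hrb : σ.var rb = N) (hcb : σ.var cb = M) (hcb' : cb < 2)
    {c c' : Fin M} (hc : σ.var 3 = c) (hc' : σ.var 4 = c') :
    (twinExpr cell rb cb).IsTrue σ ↔ Twin B c c' := by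
  rw [twinExpr, SumExpr.isTrue_all hrb, Twin]
  refine forall_congr' fun r => ?_
  set τ := σ.setVar 5 r with hτ
  have ev : ∀ y (j : Fin M), y = 3 ∨ y = 4 → τ.var y = j → (cell 5 y).eval τ = B r j := by
    intro y j hy hj
    refine hcell τ rfl (fun z hz => ?_) 5 y (by omega) (by omega) r j (by simp [hτ]) hj
    simp [hτ, show z ≠ 5 by omega]
  have hτc : τ.var 3 = c := by simp [hτ, hc]
  have hτc' : τ.var 4 = c' := by simp [hτ, hc']
  rw [SumExpr.isTrue_and, SumExpr.isTrue_isEq, SumExpr.isTrue_imp, ev 3 c (.inl rfl) hτc,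
    ev 4 c' (.inr rfl) hτc', SumExpr.isTrue_all (N := M) (by simp [hτ, hcb, show cb ≠ 5 by omega]),
    SumExpr.IsTrue, ev 3 c (.inl rfl) hτc]
  refine and_congr_right fun _ => imp_congr_right fun _ => forall_congr' fun j => ?_
  set ρ := τ.setVar 6 j with hρ
  have ev' : ∀ y (j' : Fin M), y = 3 ∨ y = 6 → ρ.var y = j' → (cell 5 y).eval ρ = B r j' := by
    intro y j' hy hj'
    refine hcell ρ rfl (fun z hz => ?_) 5 y (by omega) (by omega) r j' (by simp [hρ, hτ]) hj'
    simp [hρ, hτ, show z ≠ 5 by omega, show z ≠ 6 by omega]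
  rw [SumExpr.isTrue_imp, SumExpr.isTrue_imp, SumExpr.isTrue_or, SumExpr.isTrue_and,
    SumExpr.isTrue_and, SumExpr.isTrue_isEq, SumExpr.IsTrue.eq_1 (cell 5 6),
    ev' 3 c (.inl rfl) (by simp [hρ, hτc]), ev' 6 j (.inr rfl) (by simp [hρ])]
  simp only [SumExpr.isTrue_le, SumExpr.eval, hρ, hτ, State.setVar_var, hc, hc', Between, Fin.le_def]
  simp

/-- Column `var 3` is to be emptied: it has more than `k` twins. -/
def manyTwins (cell : ℕ → ℕ → SumExpr) (rb cb : ℕ) : SumExpr :=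
  .isLt (.var 2) (.sum 4 cb (.ite (.and (.not (.isEq (.var 4) (.var 3))) (twinExpr cell rb cb))
    (.lit 1) (.lit 0)))

open Classical in
theorem isTrue_manyTwins {cell : ℕ → ℕ → SumExpr} {rb cb N M k : ℕ}
    {B : Matrix (Fin N) (Fin M) ℕ} {σ : State} (hcell : Reads cell B σ) (hrb : σ.var rb = N)
    (hcb : σ.var cb = M) (hrb' : rb < 2) (hcb' : cb < 2) (hk : σ.var 2 = k) {c : Fin M}
    (hc : σ.var 3 = c) :
    (manyTwins cell rb cb).IsTrue σ ↔
      k < (Finset.univ.filter fun c' => c' ≠ c ∧ Twin B c c').card := by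
  rw [manyTwins, SumExpr.isTrue_isLt, SumExpr.eval, hk, SumExpr.eval, hcb, Finset.sum_range,
    Finset.card_filter]
  refine iff_of_eq (congrArg (k < ·) (Finset.sum_congr rfl fun c' _ => ?_))
  rw [SumExpr.eval_ite]
  have hcell' : Reads cell B (σ.setVar 4 c') := by
    intro τ ha hv
    refine hcell τ ha fun y hy => ?_
    rw [hv y hy]
    simp [show y ≠ 4 by omega]
  have : (SumExpr.and (.not (.isEq (.var 4) (.var 3))) (twinExpr cell rb cb)).IsTrue
      (σ.setVar 4 c') ↔ c' ≠ c ∧ Twin B c c' := by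
    rw [SumExpr.isTrue_and, SumExpr.isTrue_not, SumExpr.isTrue_isEq,
      isTrue_twinExpr hcell' (by simp [hrb, show rb ≠ 4 by omega])
        (by simp [hcb, show cb ≠ 4 by omega]) hcb' (c := c) (c' := c') (by simp [hc]) (by simp)]
    simp [SumExpr.eval, hc, Fin.ext_iff]
  simp only [this, SumExpr.eval]

/-- Pruning of all the columns: `z` is the register that `mapGrid` uses for the columns of the grid
as seen by `cell`. -/
def pruneStmt (cell : ℕ → ℕ → SumExpr) (rb cb z : ℕ) : Stmt :=
  .iterate 3 cb (.seq (.assign 12 (manyTwins cell rb cb)) (mapGrid 0 (.lit 0)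
    (.ite (.and (.isEq (.var z) (.var 3)) (.var 12)) (.lit 0) (entry 13 14))))

/-- One round of pruning replaces the grid by `V`, provided that `V` arises by emptying the cells
in the line `var 3` if the test succeeds. -/
theorem holds_den_prune_step {n m k z : ℕ} {B V : Matrix (Fin n) (Fin m) ℕ} {σ : State}
    {test : SumExpr} (h : σ.Holds B k) (hz : z = 13 ∨ z = 14) {P : Prop} [Decidable P]
    (hP : test.IsTrue σ ↔ P)
    (hV : ∀ (i : Fin n) (j : Fin m),
      V i j = if ((if z = 13 then (i : ℕ) else j) = σ.var 3 ∧ P) then 0 else B i j) :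
    ((Stmt.seq (.assign 12 test) (mapGrid 0 (.lit 0)
      (.ite (.and (.isEq (.var z) (.var 3)) (.var 12)) (.lit 0) (entry 13 14)))).den σ).Holds V k
      := by
  obtain ⟨h0, h1, h2, hB⟩ := h
  set τ := σ.setVar 12 (test.eval σ) with hτ
  have hτh : τ.Holds B k := ⟨by simp [hτ, h0], by simp [hτ, h1], by simp [hτ, h2], hB⟩
  obtain ⟨hn, -, hv⟩ := den_mapGrid (a := 0) (b := 0) (base := .lit 0)
    (e := .ite (.and (.isEq (.var z) (.var 3)) (.var 12)) (.lit 0) (entry 13 14)) (σ := τ)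
    hτh.1 hτh.2.1 V (fun _ _ => rfl) (by
      intro ρ i j hnear hi hj hp
      have hcell : (entry 13 14).eval ρ = B i j := by
        rw [entry, SumExpr.eval, SumExpr.eval_idx (by omega)
          (by rw [hi, hnear.var 0 (by omega) (by omega), hτh.1]; exact i.2), hi, hj,
          hnear.var 1 (by omega) (by omega), hτh.2.1, hp _ (by omega), hτh.2.2.2]
      classical
      rw [SumExpr.eval_ite, hcell, hV]
      have h3 : ρ.var 3 = σ.var 3 := by
        rw [hnear.var 3 (by omega) (by omega)]; simp [hτ]
      have h12 : ρ.var 12 = test.eval σ := by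
        rw [hnear.var 12 (by omega) (by omega)]; simp [hτ]
      have hzv : ρ.var z = if z = 13 then (i : ℕ) else j := by
        rcases hz with rfl | rfl <;> simp [hi, hj]
      have : (SumExpr.and (.isEq (.var z) (.var 3)) (.var 12)).IsTrue ρ ↔
          (if z = 13 then (i : ℕ) else j) = σ.var 3 ∧ P := by
        rw [SumExpr.isTrue_and, SumExpr.isTrue_isEq, ← hP, SumExpr.IsTrue, SumExpr.IsTrue]
        simp only [SumExpr.eval, h3, h12, hzv]
      simp only [this, SumExpr.eval])
  refine ⟨?_, ?_, ?_, fun i j => ?_⟩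
  · rw [Stmt.den, Stmt.den, hn.var 0 (by omega) (by omega), hτh.1]
  · rw [Stmt.den, Stmt.den, hn.var 1 (by omega) (by omega), hτh.2.1]
  · rw [Stmt.den, Stmt.den, hn.var 2 (by omega) (by omega), hτh.2.2.1]
  · have := hv i j
    rw [zero_add] at this
    exact this

theorem State.Holds.setVar {n m k x v : ℕ} {B : Matrix (Fin n) (Fin m) ℕ} {σ : State}
    (h : σ.Holds B k) (hx : 3 ≤ x) : (σ.setVar x v).Holds B k := by
  obtain ⟨h0, h1, h2, hB⟩ := h
  exact ⟨by simp [h0, show 0 ≠ x by omega], by simp [h1, show 1 ≠ x by omega],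
    by simp [h2, show 2 ≠ x by omega], hB⟩

theorem ite_zeroCol_apply {n m : ℕ} {P : Prop} [Decidable P] {c : Fin m}
    {B : Matrix (Fin n) (Fin m) ℕ} {i : Fin n} {j : Fin m} :
    (if P then zeroCol c B else B) i j = if (j : ℕ) = c ∧ P then 0 else B i j := by
  by_cases h : P <;> simp [h, zeroCol, Fin.ext_iff]

theorem holds_den_pruneCols {n m k : ℕ} {B : Matrix (Fin n) (Fin m) ℕ} {σ : State}
    (h : σ.Holds B k) : ((pruneStmt entry 0 1 14).den σ).Holds (pruneCols k B m) k := by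
  classical
  refine Stmt.den_iterate (fun l τ => τ.Holds (pruneCols k B l) k) h.2.1 (h.setVar le_rfl) ?_
  intro l hl τ hτ hτl
  refine State.Holds.setVar ?_ le_rfl
  rw [pruneCols, dif_pos hl]
  refine holds_den_prune_step hτ (.inr rfl) (isTrue_manyTwins (reads_entry hτ) hτ.1 hτ.2.1
    (by omega) (by omega) hτ.2.2.1 (c := ⟨l, hl⟩) hτl) fun i j => ?_
  rw [hτl, pruneCol]
  exact ite_zeroCol_apply

theorem holds_den_pruneRows {n m k : ℕ} {B : Matrix (Fin n) (Fin m) ℕ} {σ : State}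
    (h : σ.Holds B k) : ((pruneStmt (fun x y => entry y x) 1 0 13).den σ).Holds
      (pruneCols k B.transpose n).transpose k := by
  classical
  refine Stmt.den_iterate (fun l τ => τ.Holds (pruneCols k B.transpose l).transpose k) h.1
    (h.setVar le_rfl) ?_
  intro l hl τ hτ hτl
  refine State.Holds.setVar ?_ le_rfl
  rw [pruneCols, dif_pos hl]
  refine holds_den_prune_step hτ (.inl rfl) (isTrue_manyTwins (reads_entry_transpose hτ) hτ.2.1 hτ.1
    (by omega) (by omega) hτ.2.2.1 (c := ⟨l, hl⟩) hτl) fun i j => ?_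
  rw [hτl, pruneCol]
  exact ite_zeroCol_apply

/-- The number of buttons. -/
def countExpr : SumExpr := .sum 5 0 (.sum 6 1 (.ite (entry 5 6) (.lit 1) (.lit 0)))

theorem eval_countExpr {n m k : ℕ} {B : Matrix (Fin n) (Fin m) ℕ} {σ : State}
    (h : σ.Holds B k) : countExpr.eval σ = numButtons B := by
  rw [countExpr, SumExpr.eval, h.1, Finset.sum_range, numButtons, Finset.card_filter,
    Fintype.sum_prod_type]
  refine Finset.sum_congr rfl fun i _ => ?_
  rw [SumExpr.eval, show (σ.setVar 5 i).var 1 = m by simp [h.2.1], Finset.sum_range]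
  refine Finset.sum_congr rfl fun j _ => ?_
  have hB := reads_entry h ((σ.setVar 5 i).setVar 6 j) rfl (fun y hy => by
    simp [show y ≠ 5 by omega, show y ≠ 6 by omega]) 5 6 (by omega) (by omega) i j (by simp)
    (by simp)
  simp only [SumExpr.eval, hB]

/-- The computation of `4 * 64 ^ min k (n * m)` in register `15`. -/
def powStmt : Stmt :=
  .seq (.assign 15 (.lit 4)) (.seq (.assign 16 (.lit 0)) (.iterate 13 0 (.iterate 14 1 (.seq
    (.assign 15 (.ite (.isLt (.var 16) (.var 2))
      (SumExpr.var 15).double.double.double.double.double.double (.var 15)))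
    (.assign 16 (.ite (.isLt (.var 16) (.var 2)) (.add (.var 16) (.lit 1)) (.var 16)))))))

theorem den_powStmt {n m k : ℕ} {B : Matrix (Fin n) (Fin m) ℕ} {σ : State}
    (h : σ.Holds B k) : (powStmt.den σ).Holds B k ∧
      (powStmt.den σ).var 15 = 4 * 64 ^ min k (n * m) ∧ (powStmt.den σ).var 12 = σ.var 12 := by
  let I : ℕ → State → Prop := fun r τ => τ.Holds B k ∧ τ.var 16 = min k r ∧
    τ.var 15 = 4 * 64 ^ min k r ∧ τ.var 12 = σ.var 12
  have hI : ∀ r τ x v, x = 13 ∨ x = 14 → I r τ → I r (τ.setVar x v) := by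
    rintro r τ x v hx ⟨h₁, h₂, h₃, h₄⟩
    refine ⟨h₁.setVar (by omega), ?_⟩
    rcases hx with rfl | rfl <;> simp [h₂, h₃, h₄]
  suffices I (n * m) (powStmt.den σ) from ⟨this.1, this.2.2⟩
  simp only [powStmt, Stmt.den.eq_3]
  refine Stmt.den_iterate (fun i τ => I (i * m) τ) (by simp [Stmt.den, h.1]) ?_ ?_
  · refine hI _ _ _ _ (.inl rfl) ⟨(h.setVar (by omega)).setVar (by omega), ?_⟩
    simp [Stmt.den, SumExpr.eval]
  · intro i hi τ hτ _
    refine hI _ _ _ _ (.inl rfl) ?_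
    rw [show (i + 1) * m = i * m + m by ring]
    refine Stmt.den_iterate (fun j τ => I (i * m + j) τ) hτ.1.2.1 (hI _ _ _ _ (.inr rfl) hτ) ?_
    rintro j hj ρ ⟨h₁, h₂, h₃, h₄⟩ -
    refine hI _ _ _ _ (.inr rfl) ⟨(h₁.setVar (by omega)).setVar (by omega), ?_⟩
    have hk : ρ.var 2 = k := h₁.2.2.1
    by_cases hlt : i * m + j < k
    · have e₁ : min k (i * m + j) = i * m + j := by omega
      have e₂ : min k (i * m + (j + 1)) = i * m + j + 1 := by omega
      rw [e₁] at h₂ h₃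
      simp only [e₂]
      simp [Stmt.den, SumExpr.eval, SumExpr.eval_double, h₂, h₃, h₄, hk, hlt]
      ring
    · have e₁ : min k (i * m + j) = k := by omega
      have e₂ : min k (i * m + (j + 1)) = k := by omega
      rw [e₁] at h₂ h₃
      simp only [e₂]
      simp [Stmt.den, SumExpr.eval, h₂, h₃, h₄, hk]

/-- The reduction of an instance. -/
def reduceStmt : Stmt :=
  .seq (pruneStmt entry 0 1 14) (.seq (pruneStmt (fun x y => entry y x) 1 0 13)
    (.seq (.assign 12 countExpr) (.seq powStmt (mapGrid 0 (.lit 0)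
      (.ite (.isLt (.var 15) (.var 12))
        (.ite (.isLt (.var 2) (.idx 13 14)) (.lit 0) (.add (.idx 13 14) (.lit 1)))
        (entry 13 14))))))

theorem wf_reduceStmt : reduceStmt.wf = true := by decide

theorem holds_den_reduceStmt {n m k : ℕ} {B : Matrix (Fin n) (Fin m) ℕ} {σ : State}
    (h : σ.Holds B k) : (reduceStmt.den σ).Holds (reduced k B) k := by
  have h₁ := holds_den_pruneRows (holds_den_pruneCols h)
  rw [← pruned] at h₁
  simp only [reduceStmt, Stmt.den.eq_3]
  set σ₁ := (pruneStmt (fun x y => entry y x) 1 0 13).den ((pruneStmt entry 0 1 14).den σ)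
  rw [Stmt.den.eq_1, eval_countExpr h₁]
  obtain ⟨h₂, h15, h12⟩ := den_powStmt (h₁.setVar (x := 12) (v := numButtons (pruned k B))
    (by omega))
  simp only [State.setVar_var, if_true] at h12
  set σ₂ := powStmt.den (σ₁.setVar 12 (numButtons (pruned k B)))
  obtain ⟨h0, h1, h2, hB⟩ := h₂
  obtain ⟨hn, -, hv⟩ := den_mapGrid (a := 0) (b := 0) (base := .lit 0)
    (e := .ite (.isLt (.var 15) (.var 12))
        (.ite (.isLt (.var 2) (.idx 13 14)) (.lit 0) (.add (.idx 13 14) (.lit 1)))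
        (entry 13 14)) (σ := σ₂)
    h0 h1 (reduced k B) (fun _ _ => rfl) (by
      intro ρ i j hnear hi hj hp
      have hidx : (SumExpr.idx 13 14).eval ρ = i * m + j := by
        rw [SumExpr.eval_idx (by omega)
          (by rw [hi, hnear.var 0 (by omega) (by omega), h0]; exact i.2), hi, hj,
          hnear.var 1 (by omega) (by omega), h1]
      have hcell : (entry 13 14).eval ρ = pruned k B i j := by
        rw [entry, SumExpr.eval, hidx, hp _ (by omega), hB]
      -- The exponent may be cut off at the number of cells, which bounds the number of buttons.
      have hiff : 4 * 64 ^ min k (n * m) < numButtons (pruned k B) ↔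
          4 * 64 ^ k < numButtons (pruned k B) := by
        rcases le_total k (n * m) with hle | hle
        · rw [min_eq_left hle]
        · rw [min_eq_right hle]
          have a₁ := numButtons_le (pruned k B)
          have a₂ := lt_four_mul_pow (n * m)
          have a₃ := lt_four_mul_pow k
          exact iff_of_false (by omega) (by omega)
      have e15 : ρ.var 15 = 4 * 64 ^ min k (n * m) := by
        rw [hnear.var 15 (by omega) (by omega), h15]
      have e12 : ρ.var 12 = numButtons (pruned k B) := by
        rw [hnear.var 12 (by omega) (by omega), h12]
      have e2 : ρ.var 2 = k := by rw [hnear.var 2 (by omega) (by omega), h2]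
      classical
      rw [SumExpr.eval_ite, hcell, SumExpr.eval_ite, SumExpr.isTrue_isLt, SumExpr.isTrue_isLt,
        SumExpr.eval, SumExpr.eval, SumExpr.eval, SumExpr.eval, SumExpr.eval, SumExpr.eval, hidx,
        e15, e12, e2, hiff, reduced]
      split_ifs with hlt hk
      · simp [colourful, hk]
      · simp [colourful, hk]
      · rfl)
  refine ⟨?_, ?_, ?_, fun i j => ?_⟩
  · rw [hn.var 0 (by omega) (by omega), h0]
  · rw [hn.var 1 (by omega) (by omega), h1]
  · rw [hn.var 2 (by omega) (by omega), h2]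
  · have := hv i j
    rwa [zero_add] at this

theorem State.Holds.of_agree {n m k : ℕ} {B : Matrix (Fin n) (Fin m) ℕ} {σ τ : State}
    (h : σ.Holds B k) (ha : Agree τ σ) : τ.Holds B k := by
  obtain ⟨h0, h1, h2, hB⟩ := h
  have hs : scratch = 20 := rfl
  exact ⟨by rw [ha.var 0 (by omega), h0], by rw [ha.var 1 (by omega), h1],
    by rw [ha.var 2 (by omega), h2], by simpa [ha.arr] using hB⟩

theorem reduceStmt_exec {n m k : ℕ} {B : Matrix (Fin n) (Fin m) ℕ} {σ : State}
    (h : σ.Holds B k) : ∃ t τ, Exec reduceStmt.compile σ t τ ∧ t ≤ reduceStmt.time (n + m) ∧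
      τ.Holds (reduced k B) k := by
  obtain ⟨t, τ, hx, ht, ha⟩ := Stmt.compile_exec wf_reduceStmt (N := n + m) (σ := σ) (σ' := σ)
    ⟨rfl, fun _ _ => rfl⟩ (by rw [h.1]; omega) (by rw [h.2.1]; omega)
  exact ⟨t, τ, hx, ht, (holds_den_reduceStmt h).of_agree ha⟩

/-! ### The tree of all sequences of cuts -/

section Search

variable {n m : ℕ}

/-- The cell `(i, j)` lies in the rectangle with the corners `(i₁, j₁)` and `(i₂, j₂)`. -/
def InRect (i₁ : Fin n) (j₁ : Fin m) (i₂ : Fin n) (j₂ : Fin m) (i : Fin n) (j : Fin m) : Prop :=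
  (i₁ ≤ i ∧ i ≤ i₂) ∧ j₁ ≤ j ∧ j ≤ j₂

/-- The cells `(i₁, j₁)` and `(i₂, j₂)` are the ends of a cut of the grid `G`. -/
def IsCutBetween (G : Matrix (Fin n) (Fin m) ℕ) (i₁ : Fin n) (j₁ : Fin m) (i₂ : Fin n)
    (j₂ : Fin m) : Prop :=
  G i₁ j₁ ≠ 0 ∧ G i₂ j₂ ≠ 0 ∧ i₁ ≤ i₂ ∧ j₁ ≤ j₂ ∧ (i₁ = i₂ ∨ j₁ = j₂) ∧
    ∀ i j, InRect i₁ j₁ i₂ j₂ i j → G i j ≠ 0 → G i j = G i₁ j₁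

open Classical in
/-- The grid without the buttons in a rectangle. -/
noncomputable def clearRect (G : Matrix (Fin n) (Fin m) ℕ) (i₁ : Fin n) (j₁ : Fin m) (i₂ : Fin n)
    (j₂ : Fin m) : Matrix (Fin n) (Fin m) ℕ :=
  fun i j => if InRect i₁ j₁ i₂ j₂ i j then 0 else G i j

open Classical in
/-- The grid that results from the cut with the given ends, if there is such a cut. -/
noncomputable def successorsBetween (G : Matrix (Fin n) (Fin m) ℕ) (i₁ : Fin n) (j₁ : Fin m)
    (i₂ : Fin n) (j₂ : Fin m) : List (Matrix (Fin n) (Fin m) ℕ) :=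
  if IsCutBetween G i₁ j₁ i₂ j₂ then [clearRect G i₁ j₁ i₂ j₂] else []

/-- The grids that result from the cuts of `G`. -/
noncomputable def successors (G : Matrix (Fin n) (Fin m) ℕ) : List (Matrix (Fin n) (Fin m) ℕ) :=
  (List.finRange n).flatMap fun i₁ => (List.finRange m).flatMap fun j₁ =>
    (List.finRange n).flatMap fun i₂ => (List.finRange m).flatMap fun j₂ =>
      successorsBetween G i₁ j₁ i₂ j₂

theorem Cut.isValid_iff {C : Cut n m} {G : Matrix (Fin n) (Fin m) ℕ} :
    C.IsValid G ↔ IsCutBetween G C.first.1 C.first.2 C.last.1 C.last.2 := by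
  have hcells : ∀ i j, (i, j) ∈ C.cells ↔
      InRect C.first.1 C.first.2 C.last.1 C.last.2 i j := by
    intro i j
    cases C with
    | horizontal a b c =>
      rw [mem_cells_horizontal]
      exact and_congr_left fun _ => ⟨fun h => h ▸ ⟨le_rfl, le_rfl⟩, fun h => le_antisymm h.2 h.1⟩
    | vertical a b c =>
      rw [mem_cells_vertical]
      exact and_congr_right fun _ => ⟨fun h => h ▸ ⟨le_rfl, le_rfl⟩, fun h => le_antisymm h.2 h.1⟩
  have hline : C.first.1 = C.last.1 ∨ C.first.2 = C.last.2 := by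
    cases C with
    | horizontal a b c => exact .inl rfl
    | vertical a b c => exact .inr rfl
  constructor
  · rintro ⟨hle, h₁, h₂, h⟩
    refine ⟨h₁, h₂, hle.1, hle.2, hline, fun i j hij hne => ?_⟩
    exact h (i, j) ((hcells i j).2 hij) C.first
      ((hcells _ _).2 ⟨⟨le_rfl, hle.1⟩, le_rfl, hle.2⟩) hne h₁
  · rintro ⟨h₁, h₂, hi, hj, -, h⟩
    refine ⟨⟨hi, hj⟩, h₁, h₂, fun p hp q hq hne hne' => ?_⟩
    rw [h p.1 p.2 ((hcells _ _).1 hp) hne, h q.1 q.2 ((hcells _ _).1 hq) hne']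

theorem Cut.apply_eq_clearRect (C : Cut n m) (G : Matrix (Fin n) (Fin m) ℕ) :
    C.apply G = clearRect G C.first.1 C.first.2 C.last.1 C.last.2 := by
  classical
  ext i j
  unfold Cut.apply clearRect
  refine if_congr ?_ rfl rfl
  cases C with
  | horizontal a b c =>
    rw [mem_cells_horizontal]
    exact and_congr_left fun _ => ⟨fun h => h ▸ ⟨le_rfl, le_rfl⟩, fun h => le_antisymm h.2 h.1⟩
  | vertical a b c =>
    rw [mem_cells_vertical]
    exact and_congr_right fun _ => ⟨fun h => h ▸ ⟨le_rfl, le_rfl⟩, fun h => le_antisymm h.2 h.1⟩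

theorem mem_successors {G G' : Matrix (Fin n) (Fin m) ℕ} :
    G' ∈ successors G ↔ ∃ C : Cut n m, C.IsValid G ∧ C.apply G = G' := by
  simp only [successors, successorsBetween, List.mem_flatMap, List.mem_finRange, true_and]
  constructor
  · rintro ⟨i₁, j₁, i₂, j₂, h⟩
    split_ifs at h with hc
    · rw [List.mem_singleton] at h
      obtain ⟨C, h₁, h₂⟩ : ∃ C : Cut n m, C.first = (i₁, j₁) ∧ C.last = (i₂, j₂) := by
        rcases hc.2.2.2.2.1 with rfl | rfl
        · exact ⟨.horizontal i₁ j₁ j₂, rfl, rfl⟩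
        · exact ⟨.vertical i₁ i₂ j₁, rfl, rfl⟩
      refine ⟨C, ?_, ?_⟩
      · rw [Cut.isValid_iff, h₁, h₂]; exact hc
      · rw [Cut.apply_eq_clearRect, h₁, h₂, h]
    · simp at h
  · rintro ⟨C, hC, rfl⟩
    refine ⟨C.first.1, C.first.2, C.last.1, C.last.2, ?_⟩
    rw [if_pos (Cut.isValid_iff.1 hC), List.mem_singleton, Cut.apply_eq_clearRect]

theorem sum_map_finRange {N : ℕ} (f : Fin N → ℕ) : ((List.finRange N).map f).sum = ∑ i, f i := by
  rw [← List.ofFn_eq_map, List.sum_ofFn]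

theorem length_successors_le (G : Matrix (Fin n) (Fin m) ℕ) :
    (successors G).length ≤ numButtons G ^ 2 := by
  simp only [successors, List.length_flatMap, sum_map_finRange]
  calc _ ≤ ∑ i₁, ∑ j₁, ∑ i₂, ∑ j₂,
        (if G i₁ j₁ ≠ 0 then 1 else 0) * (if G i₂ j₂ ≠ 0 then 1 else 0) := by
        refine Finset.sum_le_sum fun i₁ _ => Finset.sum_le_sum fun j₁ _ =>
          Finset.sum_le_sum fun i₂ _ => Finset.sum_le_sum fun j₂ _ => ?_
        unfold successorsBetween
        split_ifs with h h₁ h₂ h₂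
        · simp
        · exact absurd h.2.1 h₂
        · exact absurd h.1 h₁
        · exact absurd h.1 h₁
        all_goals simp
    _ = numButtons G ^ 2 := by
        simp only [← Finset.mul_sum, ← Finset.sum_mul]
        rw [numButtons, Finset.card_filter, Fintype.sum_prod_type, sq]

/-- The grids that result from sequences of `l` cuts of `B`. -/
noncomputable def level (B : Matrix (Fin n) (Fin m) ℕ) : ℕ → List (Matrix (Fin n) (Fin m) ℕ)
  | 0 => [B]
  | l + 1 => (level B l).flatMap successors

theorem level_succ_eq (B : Matrix (Fin n) (Fin m) ℕ) (l : ℕ) :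
    level B (l + 1) = (successors B).flatMap fun G => level G l := by
  induction l with
  | zero => simp [level]
  | succ l ih => rw [level, ih, List.flatMap_assoc]; rfl

theorem zero_mem_level {B : Matrix (Fin n) (Fin m) ℕ} {l : ℕ} :
    0 ∈ level B l ↔ ∃ S : List (Cut n m), S.length = l ∧ Clears S B := by
  induction l generalizing B with
  | zero =>
    simp only [level, List.mem_singleton, List.length_eq_zero_iff, exists_eq_left, Clears, eq_comm]
  | succ l ih =>
    rw [level_succ_eq, List.mem_flatMap]
    constructor
    · rintro ⟨G, hG, h⟩
      obtain ⟨C, hC, rfl⟩ := mem_successors.1 hG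
      obtain ⟨S, hS, hc⟩ := ih.1 h
      exact ⟨C :: S, by simp [hS], hC, hc⟩
    · rintro ⟨_ | ⟨C, S⟩, hS, hc⟩
      · simp at hS
      · exact ⟨C.apply B, mem_successors.2 ⟨C, hc.1, rfl⟩, ih.2 ⟨S, by simpa using hS, hc.2⟩⟩

/-- The first levels, one after the other. -/
noncomputable def levels (B : Matrix (Fin n) (Fin m) ℕ) : ℕ → List (Matrix (Fin n) (Fin m) ℕ)
  | 0 => level B 0
  | l + 1 => levels B l ++ level B (l + 1)

theorem mem_levels {B G : Matrix (Fin n) (Fin m) ℕ} {k : ℕ} :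
    G ∈ levels B k ↔ ∃ l ≤ k, G ∈ level B l := by
  induction k with
  | zero => simp [levels]
  | succ k ih =>
    rw [levels, List.mem_append, ih]
    constructor
    · rintro (⟨l, hl, h⟩ | h)
      · exact ⟨l, by omega, h⟩
      · exact ⟨k + 1, le_rfl, h⟩
    · rintro ⟨l, hl, h⟩
      rcases hl.lt_or_eq with hlt | rfl
      · exact .inl ⟨l, by omega, h⟩
      · exact .inr h

theorem solvable_iff_zero_mem_levels {B : Matrix (Fin n) (Fin m) ℕ} {k : ℕ} :
    Solvable B k ↔ 0 ∈ levels B k := by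
  simp only [mem_levels, zero_mem_level, Solvable]
  constructor
  · rintro ⟨S, hS, hc⟩
    exact ⟨_, hS, S, rfl, hc⟩
  · rintro ⟨_, hl, S, rfl, hc⟩
    exact ⟨S, hl, hc⟩

theorem numButtons_apply_le (C : Cut n m) (B : Matrix (Fin n) (Fin m) ℕ) :
    numButtons (C.apply B) ≤ numButtons B := by
  refine Finset.card_le_card fun p hp => ?_
  rw [Finset.mem_filter] at hp ⊢
  refine ⟨hp.1, fun h => hp.2 ?_⟩
  rcases C.apply_eq_or B p.1 p.2 with h' | h'
  · rw [h', h]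
  · exact h'

theorem length_level_le (B : Matrix (Fin n) (Fin m) ℕ) (l : ℕ) :
    (level B l).length ≤ (numButtons B ^ 2) ^ l := by
  suffices ∀ N, numButtons B ≤ N → (level B l).length ≤ (N ^ 2) ^ l from this _ le_rfl
  intro N hN
  induction l generalizing B with
  | zero => simp [level]
  | succ l ih =>
    rw [level_succ_eq, List.length_flatMap]
    have h : ∀ x ∈ (successors B).map fun G => (level G l).length, x ≤ (N ^ 2) ^ l := by
      intro x hx
      obtain ⟨G, hG, rfl⟩ := List.mem_map.1 hx
      obtain ⟨C, -, rfl⟩ := mem_successors.1 hG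
      exact ih _ ((numButtons_apply_le C B).trans hN)
    have h' := List.sum_le_card_nsmul _ _ h
    rw [List.length_map, smul_eq_mul] at h'
    calc _ ≤ (successors B).length * (N ^ 2) ^ l := h'
      _ ≤ N ^ 2 * (N ^ 2) ^ l :=
        Nat.mul_le_mul_right _ ((length_successors_le B).trans (Nat.pow_le_pow_left hN 2))
      _ = _ := by ring

theorem length_level_le_of_le {B : Matrix (Fin n) (Fin m) ℕ} {l k : ℕ} (hl : l ≤ k) :
    (level B l).length ≤ (numButtons B ^ 2 + 1) ^ k :=
  (length_level_le B l).trans ((Nat.pow_le_pow_left (Nat.le_succ _) l).trans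
    (Nat.pow_le_pow_right (Nat.succ_pos _) hl))

theorem length_levels_le {B : Matrix (Fin n) (Fin m) ℕ} (k : ℕ) :
    (levels B k).length ≤ (k + 1) * (numButtons B ^ 2 + 1) ^ k := by
  suffices ∀ l ≤ k, (levels B l).length ≤ (l + 1) * (numButtons B ^ 2 + 1) ^ k from this k le_rfl
  intro l
  induction l with
  | zero => intro _; simpa [levels] using length_level_le_of_le (B := B) (Nat.zero_le k)
  | succ l ih =>
    intro hl
    rw [levels, List.length_append, Nat.add_mul (l + 1), Nat.one_mul]
    exact Nat.add_le_add (ih (by omega)) (length_level_le_of_le hl)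

end Search

/-! ### The program that searches the tree -/

section SearchProgram

variable {n m k : ℕ}

/-- The memory contains the grids `q` in array `1`, one after the other. Register `9` contains the
number `h` of those that have been processed, and register `8` the position of the next one;
registers `11` and `10` contain the number of all of them and the position of the first free
cell. -/
structure Queue (k : ℕ) (q : List (Matrix (Fin n) (Fin m) ℕ)) (h : ℕ) (σ : State) : Prop where
  rows : σ.var 0 = n
  cols : σ.var 1 = m
  cuts : σ.var 2 = k
  headPos : σ.var 8 = h * (n * m)
  head : σ.var 9 = h
  tailPos : σ.var 10 = q.length * (n * m)
  tail : σ.var 11 = q.length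
  cells : ∀ (g : ℕ) (hg : g < q.length) (i : Fin n) (j : Fin m),
    σ.arr 1 (g * (n * m) + (i * m + j)) = q[g] i j

theorem Queue.setVar {q : List (Matrix (Fin n) (Fin m) ℕ)} {h : ℕ} {σ : State}
    (hq : Queue k q h σ) {x v : ℕ} (hx : 3 ≤ x ∧ x < 8 ∨ 12 ≤ x) : Queue k q h (σ.setVar x v) := by
  obtain ⟨h₀, h₁, h₂, h₃, h₄, h₅, h₆, h₇⟩ := hq
  constructor
  case cells => exact h₇
  all_goals rw [State.setVar_var, if_neg (by omega)]; assumption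

theorem Queue.of_agree {q : List (Matrix (Fin n) (Fin m) ℕ)} {h : ℕ} {σ τ : State}
    (hq : Queue k q h σ) (ha : Agree τ σ) : Queue k q h τ := by
  obtain ⟨h₀, h₁, h₂, h₃, h₄, h₅, h₆, h₇⟩ := hq
  have hs : scratch = 20 := rfl
  constructor
  case cells => simpa [ha.arr] using h₇
  all_goals rw [ha.var _ (by omega)]; assumption

/-- The grid at the position `var 8` of array `1` is `G`. -/
structure ReadsQueue (G : Matrix (Fin n) (Fin m) ℕ) (σ : State) : Prop where
  rows : σ.var 0 = n
  cols : σ.var 1 = m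
  cells : ∀ (i : Fin n) (j : Fin m), σ.arr 1 (σ.var 8 + (i * m + j)) = G i j

theorem ReadsQueue.setVar {G : Matrix (Fin n) (Fin m) ℕ} {σ : State} (h : ReadsQueue G σ)
    {x v : ℕ} (hx : 2 ≤ x) (hx' : x ≠ 8) : ReadsQueue G (σ.setVar x v) := by
  obtain ⟨h₀, h₁, h₂⟩ := h
  constructor
  case cells => simpa [hx'.symm] using h₂
  all_goals rw [State.setVar_var, if_neg (by omega)]; assumption

theorem Queue.readsQueue {q : List (Matrix (Fin n) (Fin m) ℕ)} {h : ℕ} {σ : State}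
    {G : Matrix (Fin n) (Fin m) ℕ} (hq : Queue k q h σ) (hG : q[h]? = some G) :
    ReadsQueue G σ := by
  obtain ⟨hlt, rfl⟩ := List.getElem?_eq_some_iff.1 hG
  exact ⟨hq.rows, hq.cols, fun i j => by rw [hq.headPos, hq.cells h hlt]⟩

/-- The entry in row `var i` and column `var j` of the grid at the position `var 8` of
array `1`. -/
def queueEntry (i j : ℕ) : SumExpr := .get 1 (.add (.var 8) (.idx i j))

theorem ReadsQueue.eval {G : Matrix (Fin n) (Fin m) ℕ} {σ : State} (h : ReadsQueue G σ) {x y : ℕ}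
    (hx : x ≠ 7) {i : Fin n} {j : Fin m} (hi : σ.var x = i) (hj : σ.var y = j) :
    (queueEntry x y).eval σ = G i j := by
  rw [queueEntry, SumExpr.eval, SumExpr.eval, SumExpr.eval_idx hx (by rw [hi, h.rows]; exact i.2),
    hi, hj, h.cols, SumExpr.eval, h.cells]

/-- The cell `(var 13, var 14)` lies in the rectangle with the corners `(var 3, var 4)` and
`(var 5, var 6)`. -/
def inRectExpr : SumExpr :=
  .and (.and (.le (.var 3) (.var 13)) (.le (.var 13) (.var 5)))
    (.and (.le (.var 4) (.var 14)) (.le (.var 14) (.var 6)))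

/-- The registers `3`, `4`, `5`, `6` contain the given numbers. -/
def Corners (i₁ j₁ i₂ j₂ : ℕ) (σ : State) : Prop :=
  σ.var 3 = i₁ ∧ σ.var 4 = j₁ ∧ σ.var 5 = i₂ ∧ σ.var 6 = j₂

theorem isTrue_inRectExpr {i₁ i₂ i : Fin n} {j₁ j₂ j : Fin m} {σ : State}
    (h : Corners i₁ j₁ i₂ j₂ σ) (hi : σ.var 13 = i) (hj : σ.var 14 = j) :
    inRectExpr.IsTrue σ ↔ InRect i₁ j₁ i₂ j₂ i j := by
  obtain ⟨h₁, h₂, h₃, h₄⟩ := h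
  simp only [inRectExpr, SumExpr.isTrue_and, SumExpr.isTrue_le, SumExpr.eval, h₁, h₂, h₃, h₄, hi,
    hj, InRect, Fin.le_def]

/-- The cells `(var 3, var 4)` and `(var 5, var 6)` are the ends of a cut. -/
def isCutExpr : SumExpr :=
  .and (queueEntry 3 4) (.and (queueEntry 5 6) (.and (.le (.var 3) (.var 5))
    (.and (.le (.var 4) (.var 6)) (.and (.or (.isEq (.var 3) (.var 5)) (.isEq (.var 4) (.var 6)))
      (.all 13 0 (.all 14 1 (.imp inRectExpr (.imp (queueEntry 13 14)
        (.isEq (queueEntry 13 14) (queueEntry 3 4))))))))))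

theorem isTrue_isCutExpr {G : Matrix (Fin n) (Fin m) ℕ} {i₁ i₂ : Fin n} {j₁ j₂ : Fin m}
    {σ : State} (hG : ReadsQueue G σ) (h : Corners i₁ j₁ i₂ j₂ σ) :
    isCutExpr.IsTrue σ ↔ IsCutBetween G i₁ j₁ i₂ j₂ := by
  have hall : (SumExpr.all 13 0 (.all 14 1 (.imp inRectExpr (.imp (queueEntry 13 14)
        (.isEq (queueEntry 13 14) (queueEntry 3 4)))))).IsTrue σ ↔
      ∀ i j, InRect i₁ j₁ i₂ j₂ i j → G i j ≠ 0 → G i j = G i₁ j₁ := by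
    rw [SumExpr.isTrue_all hG.rows]
    refine forall_congr' fun i => ?_
    rw [SumExpr.isTrue_all (N := m) (by simp [hG.cols])]
    refine forall_congr' fun j => ?_
    set τ := (σ.setVar 13 i).setVar 14 j with hτ
    have hGτ : ReadsQueue G τ := (hG.setVar (by omega) (by omega)).setVar (by omega) (by omega)
    have hc : Corners i₁ j₁ i₂ j₂ τ := by
      obtain ⟨h₁, h₂, h₃, h₄⟩ := h
      simp [Corners, hτ, h₁, h₂, h₃, h₄]
    have hi : τ.var 13 = i := by simp [hτ]
    have hj : τ.var 14 = j := by simp [hτ]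
    rw [SumExpr.isTrue_imp, SumExpr.isTrue_imp, SumExpr.isTrue_isEq, isTrue_inRectExpr hc hi hj,
      SumExpr.IsTrue, hGτ.eval (by omega) hi hj, hGτ.eval (by omega) hc.1 hc.2.1]
  simp only [isCutExpr, SumExpr.isTrue_and, hall]
  rw [SumExpr.IsTrue, SumExpr.IsTrue, hG.eval (by omega) h.1 h.2.1,
    hG.eval (by omega) h.2.2.1 h.2.2.2]
  obtain ⟨h₁, h₂, h₃, h₄⟩ := h
  simp only [SumExpr.isTrue_le, SumExpr.isTrue_or, SumExpr.isTrue_isEq, SumExpr.eval, h₁, h₂, h₃,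
    h₄, IsCutBetween, Fin.le_def, Fin.ext_iff]

/-- If `(var 3, var 4)` and `(var 5, var 6)` are the ends of a cut of the current grid, then the
resulting grid is appended to the queue. The copy of the grid is made in any case, behind the end of
the queue, and becomes a part of it only if there is such a cut. -/
def appendStmt : Stmt :=
  .seq (.assign 12 isCutExpr) (.seq
    (mapGrid 1 (.var 10) (.ite inRectExpr (.lit 0) (queueEntry 13 14))) (.seq
    (.assign 10 (.ite (.var 12) (.add (.var 10) .area) (.var 10)))
    (.assign 11 (.ite (.var 12) (.add (.var 11) (.lit 1)) (.var 11)))))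

theorem queue_den_appendStmt {q : List (Matrix (Fin n) (Fin m) ℕ)} {h : ℕ}
    {G : Matrix (Fin n) (Fin m) ℕ} {σ : State} (hq : Queue k q h σ) (hG : q[h]? = some G)
    {i₁ i₂ : Fin n} {j₁ j₂ : Fin m} (hc : Corners i₁ j₁ i₂ j₂ σ) :
    Queue k (q ++ successorsBetween G i₁ j₁ i₂ j₂) h (appendStmt.den σ) := by
  classical
  set σ₁ := σ.setVar 12 (isCutExpr.eval σ) with hσ₁
  have hq₁ : Queue k q h σ₁ := hq.setVar (by omega)
  have hc₁ : Corners i₁ j₁ i₂ j₂ σ₁ := by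
    obtain ⟨h₁, h₂, h₃, h₄⟩ := hc
    simp [Corners, hσ₁, h₁, h₂, h₃, h₄]
  have hG₁ := hq₁.readsQueue hG
  have hlt : h < q.length := (List.getElem?_eq_some_iff.1 hG).1
  -- The current grid ends before the free cells begin.
  have hend : ∀ g < q.length, g * (n * m) + n * m ≤ q.length * (n * m) := by
    intro g hg
    calc g * (n * m) + n * m = (g + 1) * (n * m) := by ring
      _ ≤ _ := Nat.mul_le_mul_right _ hg
  obtain ⟨hn, hold, hnew⟩ := den_mapGrid (a := 1) (b := q.length * (n * m)) (base := .var 10)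
    (e := .ite inRectExpr (.lit 0) (queueEntry 13 14)) (σ := σ₁) hq₁.rows hq₁.cols
    (clearRect G i₁ j₁ i₂ j₂)
    (fun τ hτ => by rw [SumExpr.eval, hτ.var 10 (by omega) (by omega), hq₁.tailPos]) (by
      intro τ i j hτ hi hj hp
      have hcτ : Corners i₁ j₁ i₂ j₂ τ := by
        obtain ⟨h₁, h₂, h₃, h₄⟩ := hc₁
        refine ⟨?_, ?_, ?_, ?_⟩ <;> rw [hτ.var _ (by omega) (by omega)] <;> assumption
      have hGτ : ReadsQueue G τ := by
        refine ⟨?_, ?_, fun i' j' => ?_⟩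
        · rw [hτ.var _ (by omega) (by omega), hG₁.rows]
        · rw [hτ.var _ (by omega) (by omega), hG₁.cols]
        · rw [hτ.var _ (by omega) (by omega), hp, hG₁.cells]
          have := hend h hlt
          have := cell_lt i' j'
          rw [hq₁.headPos]
          omega
      rw [SumExpr.eval_ite, isTrue_inRectExpr hcτ hi hj, hGτ.eval (by omega) hi hj]
      rfl)
  have hden : appendStmt.den σ = ((Stmt.assign 10 (.ite (.var 12) (.add (.var 10) .area)
      (.var 10))).seq (.assign 11 (.ite (.var 12) (.add (.var 11) (.lit 1)) (.var 11)))).den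
      ((mapGrid 1 (.var 10) (.ite inRectExpr (.lit 0) (queueEntry 13 14))).den σ₁) := rfl
  rw [hden]
  set σ₂ := (mapGrid 1 (.var 10) (.ite inRectExpr (.lit 0) (queueEntry 13 14))).den σ₁
  have hv : ∀ y, y ≠ 13 → y ≠ 14 → σ₂.var y = σ₁.var y := hn.var
  have h0 : σ₂.var 0 = n := by rw [hv 0 (by omega) (by omega), hq₁.rows]
  have h1 : σ₂.var 1 = m := by rw [hv 1 (by omega) (by omega), hq₁.cols]
  have h2 : σ₂.var 2 = k := by rw [hv 2 (by omega) (by omega), hq₁.cuts]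
  have h8 : σ₂.var 8 = h * (n * m) := by rw [hv 8 (by omega) (by omega), hq₁.headPos]
  have h9 : σ₂.var 9 = h := by rw [hv 9 (by omega) (by omega), hq₁.head]
  have h10 : σ₂.var 10 = q.length * (n * m) := by rw [hv 10 (by omega) (by omega), hq₁.tailPos]
  have h11 : σ₂.var 11 = q.length := by rw [hv 11 (by omega) (by omega), hq₁.tail]
  have h12 : σ₂.var 12 ≠ 0 ↔ IsCutBetween G i₁ j₁ i₂ j₂ := by
    rw [hv 12 (by omega) (by omega), ← isTrue_isCutExpr (hq.readsQueue hG) hc]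
    simp [hσ₁, SumExpr.IsTrue]
  have hcells : ∀ (g : ℕ) (hg : g < q.length) (i : Fin n) (j : Fin m),
      σ₂.arr 1 (g * (n * m) + (i * m + j)) = q[g] i j := by
    intro g hg i j
    rw [hold, hq₁.cells g hg]
    have := hend g hg
    have := cell_lt i j
    omega
  by_cases hcut : IsCutBetween G i₁ j₁ i₂ j₂
  · have h12' := h12.2 hcut
    rw [successorsBetween, if_pos hcut]
    constructor
    case cells =>
      intro g hg i j
      simp only [Stmt.den, State.setVar_arr]
      rw [List.length_append, List.length_singleton] at hg
      by_cases hg' : g < q.length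
      · rw [List.getElem_append_left hg', hcells]
      · obtain rfl : g = q.length := by omega
        simpa using hnew i j
    all_goals
      simp [Stmt.den, SumExpr.eval, SumExpr.eval_area, h0, h1, h2, h8, h9, h10, h11, h12',
        Nat.add_mul]
  · have h12' : σ₂.var 12 = 0 := by
      by_contra hne
      exact hcut (h12.1 hne)
    rw [successorsBetween, if_neg hcut, List.append_nil]
    constructor
    case cells => exact hcells
    all_goals simp [Stmt.den, SumExpr.eval, h0, h1, h2, h8, h9, h10, h11, h12']

/-- A loop whose rounds append the lists `F i` to a list that is represented in the memory appends
the concatenation of these lists. -/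
theorem den_iterate_append {α : Type*} {x b N : ℕ} {s : Stmt} (R : List α → State → Prop)
    (F : Fin N → List α) {σ : State} {q : List α} (hN : σ.var b = N) (hq : R q σ)
    (hx : ∀ q τ v, R q τ → R q (τ.setVar x v))
    (step : ∀ (i : Fin N) q τ, R q τ → τ.var x = i → R (q ++ F i) (s.den τ)) :
    R (q ++ (List.finRange N).flatMap F) ((Stmt.iterate x b s).den σ) := by
  have := Stmt.den_iterate (x := x) (s := s)
    (fun i τ => R (q ++ ((List.finRange N).take i).flatMap F) τ) hN
    (by simpa using hx _ _ _ hq) (by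
      intro i hi τ hτ hτi
      have h := hx _ _ (i + 1) (step ⟨i, hi⟩ _ τ hτ hτi)
      rwa [List.append_assoc, show ((List.finRange N).take i).flatMap F ++ F ⟨i, hi⟩ =
        ((List.finRange N).take (i + 1)).flatMap F by
          rw [List.take_add_one, List.getElem?_eq_getElem (by simpa using hi)]; simp] at h)
  rwa [List.take_of_length_le (by simp)] at this

/-- All the cuts of the current grid are tried, and the next grid of the queue becomes the
current one. -/
def processStmt : Stmt :=
  .seq (.iterate 3 0 (.iterate 4 1 (.iterate 5 0 (.iterate 6 1 appendStmt))))
    (.seq (.assign 8 (.add (.var 8) .area)) (.assign 9 (.add (.var 9) (.lit 1))))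

theorem wf_processStmt : processStmt.wf = true := by decide

theorem queue_den_processStmt {q : List (Matrix (Fin n) (Fin m) ℕ)} {h : ℕ}
    {G : Matrix (Fin n) (Fin m) ℕ} {σ : State} (hq : Queue k q h σ) (hG : q[h]? = some G) :
    Queue k (q ++ successors G) (h + 1) (processStmt.den σ) := by
  let R : List (Matrix (Fin n) (Fin m) ℕ) → State → Prop := fun q τ =>
    Queue k q h τ ∧ q[h]? = some G
  have hR : ∀ q τ x v, 3 ≤ x ∧ x < 8 → R q τ → R q (τ.setVar x v) :=
    fun q τ x v hx hτ => ⟨hτ.1.setVar (.inl hx), hτ.2⟩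
  have key : R (q ++ successors G)
      ((Stmt.iterate 3 0 (.iterate 4 1 (.iterate 5 0 (.iterate 6 1 appendStmt)))).den σ) := by
    refine den_iterate_append R _ hq.rows ⟨hq, hG⟩ (fun q τ v => hR q τ 3 v (by omega)) ?_
    intro i₁ q τ hτ h₁
    refine (den_iterate_append (fun q τ => R q τ ∧ τ.var 3 = i₁) _ hτ.1.cols ⟨hτ, h₁⟩
      (fun q τ v h => ⟨hR q τ 4 v (by omega) h.1, by simp [h.2]⟩) ?_).1
    rintro j₁ q τ ⟨hτ, h₁⟩ h₂
    refine (den_iterate_append (fun q τ => R q τ ∧ τ.var 3 = i₁ ∧ τ.var 4 = j₁) _ hτ.1.rows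
      ⟨hτ, h₁, h₂⟩ (fun q τ v h => ⟨hR q τ 5 v (by omega) h.1, by simp [h.2]⟩) ?_).imp_right
        And.left
    rintro i₂ q τ ⟨hτ, h₁, h₂⟩ h₃
    refine (den_iterate_append
      (fun q τ => R q τ ∧ τ.var 3 = i₁ ∧ τ.var 4 = j₁ ∧ τ.var 5 = i₂) _ hτ.1.cols
      ⟨hτ, h₁, h₂, h₃⟩ (fun q τ v h => ⟨hR q τ 6 v (by omega) h.1, by simp [h.2]⟩)
      ?_).imp_right fun h => ⟨h.1, h.2.1⟩
    rintro j₂ q τ ⟨hτ, h₁, h₂, h₃⟩ h₄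
    refine ⟨⟨queue_den_appendStmt hτ.1 hτ.2 ⟨h₁, h₂, h₃, h₄⟩, ?_⟩, ?_, ?_, ?_⟩
    · rw [List.getElem?_append_left (List.getElem?_eq_some_iff.1 hτ.2).1]
      exact hτ.2
    · rw [Stmt.den_var (by decide), h₁]
    · rw [Stmt.den_var (by decide), h₂]
    · rw [Stmt.den_var (by decide), h₃]
  obtain ⟨h₀, h₁, h₂, h₃, h₄, h₅, h₆, h₇⟩ := key.1
  simp only [processStmt, Stmt.den.eq_3]
  set τ := (Stmt.iterate 3 0 (.iterate 4 1 (.iterate 5 0 (.iterate 6 1 appendStmt)))).den σ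
  constructor
  case cells => exact h₇
  all_goals simp only [Stmt.den, SumExpr.eval, SumExpr.eval_area, State.setVar_var]
  all_goals simp [h₀, h₁, h₂, h₃, h₄, h₅, h₆, Nat.add_mul]

/-- The queue that consists of the grid in array `0`. -/
def initStmt : Stmt :=
  .seq (mapGrid 1 (.lit 0) (entry 13 14)) (.seq (.assign 8 (.lit 0)) (.seq (.assign 9 (.lit 0))
    (.seq (.assign 10 .area) (.assign 11 (.lit 1)))))

theorem wf_initStmt : initStmt.wf = true := by decide

theorem queue_den_initStmt {B : Matrix (Fin n) (Fin m) ℕ} {σ : State} (h : σ.Holds B k) :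
    Queue k [B] 0 (initStmt.den σ) := by
  obtain ⟨hn, -, hnew⟩ := den_mapGrid (a := 1) (b := 0) (base := .lit 0) (e := entry 13 14) (σ := σ)
    h.1 h.2.1 B (fun _ _ => rfl) (by
      intro τ i j hτ hi hj _
      exact reads_entry h τ (hτ.arr 0 (by omega)) (fun y hy => hτ.var y (by omega) (by omega)) 13 14
        (by omega) (by omega) i j hi hj)
  simp only [initStmt, Stmt.den.eq_3]
  set τ := (mapGrid 1 (.lit 0) (entry 13 14)).den σ
  have h0 : τ.var 0 = n := by rw [hn.var 0 (by omega) (by omega), h.1]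
  have h1 : τ.var 1 = m := by rw [hn.var 1 (by omega) (by omega), h.2.1]
  have h2 : τ.var 2 = k := by rw [hn.var 2 (by omega) (by omega), h.2.2.1]
  constructor
  case cells =>
    intro g hg i j
    obtain rfl : g = 0 := by simpa using hg
    simpa [Stmt.den] using hnew i j
  all_goals simp [Stmt.den, SumExpr.eval, SumExpr.eval_area, h0, h1, h2]

/-- The test whether the current grid is empty. -/
def checkStmt : Stmt :=
  .seq (.assign 18 (.ite (.ex 13 0 (.ex 14 1 (queueEntry 13 14))) (.var 18) (.lit 1)))
    (.assign 8 (.add (.var 8) .area))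

theorem wf_checkStmt : checkStmt.wf = true := by decide

open Classical in
theorem den_checkStmt {G : Matrix (Fin n) (Fin m) ℕ} {σ : State} (h : ReadsQueue G σ) :
    checkStmt.den σ = (σ.setVar 18 (if G = 0 then 1 else σ.var 18)).setVar 8
      (σ.var 8 + n * m) := by
  have : (SumExpr.ex 13 0 (.ex 14 1 (queueEntry 13 14))).IsTrue σ ↔ G ≠ 0 := by
    rw [SumExpr.isTrue_ex h.rows]
    have : ∀ i : Fin n, (SumExpr.ex 14 1 (queueEntry 13 14)).IsTrue (σ.setVar 13 i) ↔
        ∃ j, G i j ≠ 0 := by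
      intro i
      rw [SumExpr.isTrue_ex (N := m) (by simp [h.cols])]
      refine exists_congr fun j => ?_
      rw [SumExpr.IsTrue, ((h.setVar (by omega) (by omega)).setVar (by omega) (by omega)).eval
        (i := i) (j := j) (by omega) (by simp) (by simp)]
    simp only [this]
    constructor
    · rintro ⟨i, j, hij⟩ rfl
      exact hij rfl
    · intro hne
      by_contra! hcon
      exact hne (by ext i j; exact hcon i j)
  simp only [checkStmt, Stmt.den, SumExpr.eval_ite, this]
  simp [SumExpr.eval, SumExpr.eval_area, h.rows, h.cols]

/-- The search: `var 2` times all the grids of the queue that have not been processed yet are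
processed. Afterwards it is checked whether some grid of the queue is empty. -/
def searchProgram : Program :=
  .seq initStmt.compile (.seq
    (forLoop 16 2 (.seq (.assign 15 (.sub (.var 11) (.var 9))) (forLoop 17 15 processStmt.compile)))
    (.seq (.assign 8 (.lit 0)) (.seq (.assign 18 (.lit 0))
      (.seq (forLoop 17 11 checkStmt.compile) (.assign 0 (.var 18))))))

/-- One level of the tree is processed. -/
theorem forLoop_processStmt_exec {p L : List (Matrix (Fin n) (Fin m) ℕ)} {σ : State}
    (hq : Queue k (p ++ L) p.length σ) (h15 : σ.var 15 = L.length) :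
    ∃ t τ, Exec (forLoop 17 15 processStmt.compile) σ t τ ∧
      t ≤ L.length * (processStmt.time (n + m) + 8) + 6 ∧
      Queue k (p ++ L ++ L.flatMap successors) (p ++ L).length τ ∧ τ.var 16 = σ.var 16 := by
  have hs : scratch = 20 := rfl
  obtain ⟨t, τ, hx, ht, hI, -⟩ := forLoop_exec (x := 17) (b := 15) (N := L.length)
    (T := processStmt.time (n + m)) (P := processStmt.compile)
    (fun g τ => Queue k (p ++ L ++ (L.take g).flatMap successors) (p.length + g) τ ∧
      τ.var 16 = σ.var 16) (σ := σ) (by omega) h15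
    ⟨by simpa using hq.setVar (by omega), by simp⟩ (by
      rintro g hg τ ⟨hτ, h16⟩ h17 h15
      obtain ⟨t, ρ, hx, ht, ha⟩ := Stmt.compile_exec wf_processStmt (N := n + m) (σ := τ) (σ' := τ)
        ⟨rfl, fun _ _ => rfl⟩ (by rw [hτ.rows]; omega) (by rw [hτ.cols]; omega)
      have hget : (p ++ L ++ (L.take g).flatMap successors)[p.length + g]? = some L[g] := by
        rw [List.append_assoc, List.getElem?_append_right (by omega), Nat.add_sub_cancel_left,
          List.getElem?_append_left hg, List.getElem?_eq_getElem hg]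
      have hQ := (queue_den_processStmt hτ hget).of_agree ha
      refine ⟨t, ρ, hx, ht, ?_, ?_, ?_, ?_⟩
      · rw [ha.var 17 (by omega), Stmt.den_var (by decide), h17]
      · rw [ha.var 15 (by omega), Stmt.den_var (by decide), h15]
      · rw [List.take_add_one, List.getElem?_eq_getElem hg, Option.toList_some,
          List.flatMap_append, List.flatMap_singleton, ← List.append_assoc]
        exact hQ.setVar (by omega)
      · rw [State.setVar_var, if_neg (by omega), ha.var 16 (by omega), Stmt.den_var (by decide),
          h16])
  refine ⟨t, τ, hx, ht, ?_, hI.2⟩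
  simpa using hI.1

/-- The queue after `l` levels: all of the levels up to `l`, where the last one is not yet
processed. -/
def LevelQueue (B : Matrix (Fin n) (Fin m) ℕ) (k l : ℕ) (σ : State) : Prop :=
  ∃ p, p ++ level B l = levels B l ∧ Queue k (p ++ level B l) p.length σ

theorem forLoop_levels_exec {B : Matrix (Fin n) (Fin m) ℕ} {σ : State}
    (hq : LevelQueue B k 0 σ) :
    ∃ t τ, Exec (forLoop 16 2 (.seq (.assign 15 (.sub (.var 11) (.var 9)))
        (forLoop 17 15 processStmt.compile))) σ t τ ∧
      t ≤ k * ((numButtons B ^ 2 + 1) ^ k * (processStmt.time (n + m) + 8) + 10 + 8) + 6 ∧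
      LevelQueue B k k τ := by
  have h2 : σ.var 2 = k := by
    obtain ⟨p, -, hp⟩ := hq
    exact hp.cuts
  have hset : ∀ l τ x v, 12 ≤ x → LevelQueue B k l τ → LevelQueue B k l (τ.setVar x v) := by
    rintro l τ x v hx ⟨p, hp, hQ⟩
    exact ⟨p, hp, hQ.setVar (by omega)⟩
  obtain ⟨t, τ, hx, ht, hI, -⟩ := forLoop_exec (x := 16) (b := 2) (N := k)
    (T := (numButtons B ^ 2 + 1) ^ k * (processStmt.time (n + m) + 8) + 10)
    (P := .seq (.assign 15 (.sub (.var 11) (.var 9))) (forLoop 17 15 processStmt.compile))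
    (LevelQueue B k) (σ := σ) (by omega) h2 (hset _ _ _ _ (by omega) hq) (by
      rintro l hl τ ⟨p, hp, hQ⟩ h16 h2
      obtain ⟨t, ρ, hx, ht, hQ', h16'⟩ := forLoop_processStmt_exec
        (σ := τ.setVar 15 ((Expr.sub (.var 11) (.var 9)).eval τ)) (hQ.setVar (by omega))
        (by simp [Expr.eval, hQ.tail, hQ.head])
      refine ⟨_, ρ, Exec.seq (Exec.assign _ _ _) hx, ?_, ?_, hQ'.cuts, ?_⟩
      · have hlen := length_level_le_of_le (B := B) (le_of_lt hl)
        have := Nat.mul_le_mul_right (processStmt.time (n + m) + 8) hlen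
        simp only [Expr.cost]
        omega
      · rw [h16', State.setVar_var, if_neg (by omega), h16]
      · refine hset _ _ _ _ (by omega) ⟨p ++ level B l, ?_, hQ'⟩
        rw [hp]
        rfl)
  exact ⟨t, τ, hx, ht, hI⟩

theorem forLoop_checkStmt_exec {q : List (Matrix (Fin n) (Fin m) ℕ)} {h : ℕ} {σ : State}
    (hq : Queue k q h σ) :
    ∃ t τ, Exec (forLoop 17 11 checkStmt.compile) ((σ.setVar 8 0).setVar 18 0) t τ ∧
      t ≤ q.length * (checkStmt.time (n + m) + 8) + 6 ∧
      (0 ∈ q → τ.var 18 = 1) ∧ (0 ∉ q → τ.var 18 = 0) := by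
  classical
  have hs : scratch = 20 := rfl
  obtain ⟨t, τ, hx, ht, hI, -⟩ := forLoop_exec (x := 17) (b := 11) (N := q.length)
    (T := checkStmt.time (n + m)) (P := checkStmt.compile)
    (fun g τ => τ.arr = σ.arr ∧ τ.var 0 = n ∧ τ.var 1 = m ∧ τ.var 8 = g * (n * m) ∧
      τ.var 18 = if 0 ∈ q.take g then 1 else 0) (σ := (σ.setVar 8 0).setVar 18 0) (by omega)
    (by simp [hq.tail]) (by simp [hq.rows, hq.cols]) (by
      rintro g hg τ ⟨harr, h0, h1, h8, h18⟩ h17 h11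
      have hG : ReadsQueue q[g] τ := ⟨h0, h1, fun i j => by rw [harr, h8, hq.cells g hg]⟩
      obtain ⟨t, ρ, hx, ht, ha⟩ := Stmt.compile_exec wf_checkStmt (N := n + m) (σ := τ) (σ' := τ)
        ⟨rfl, fun _ _ => rfl⟩ (by rw [h0]; omega) (by rw [h1]; omega)
      rw [den_checkStmt hG] at ha
      refine ⟨t, ρ, hx, ht, ?_, ?_, ?_, ?_, ?_, ?_, ?_⟩
      · rw [ha.var 17 (by omega)]; simp [h17]
      · rw [ha.var 11 (by omega)]; simp [h11]
      · rw [State.setVar_arr, ha.arr]; exact harr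
      · rw [State.setVar_var, if_neg (by omega), ha.var 0 (by omega)]; simp [h0]
      · rw [State.setVar_var, if_neg (by omega), ha.var 1 (by omega)]; simp [h1]
      · rw [State.setVar_var, if_neg (by omega), ha.var 8 (by omega)]; simp [h8]; ring
      · rw [State.setVar_var, if_neg (by omega), ha.var 18 (by omega), List.take_add_one,
          List.getElem?_eq_getElem hg]
        simp only [List.mem_append, Option.toList_some, List.mem_singleton]
        by_cases hz : q[g] = 0
        · simp [hz]
        · simp [hz, h18, Ne.symm hz])
  refine ⟨t, τ, hx, ht, ?_⟩
  have h18 := hI.2.2.2.2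
  rw [List.take_length] at h18
  exact ⟨fun h => by rw [h18, if_pos h], fun h => by rw [h18, if_neg h]⟩

/-- A polynomial that bounds the time for each part of the search. -/
def searchTime (N : ℕ) : ℕ :=
  initStmt.time N + processStmt.time N + checkStmt.time N + 60

theorem searchProgram_exec {B : Matrix (Fin n) (Fin m) ℕ} {σ : State} (h : σ.Holds B k) :
    ∃ t τ, Exec searchProgram σ t τ ∧
      t ≤ (k + 1) * (numButtons B ^ 2 + 1) ^ k * searchTime (n + m) ∧
      (Solvable B k → τ.var 0 = 1) ∧ (¬ Solvable B k → τ.var 0 = 0) := by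
  obtain ⟨t₁, τ₁, hx₁, ht₁, ha₁⟩ := Stmt.compile_exec wf_initStmt (N := n + m) (σ := σ) (σ' := σ)
    ⟨rfl, fun _ _ => rfl⟩ (by rw [h.1]; omega) (by rw [h.2.1]; omega)
  have hq₁ : LevelQueue B k 0 τ₁ := ⟨[], rfl, (queue_den_initStmt h).of_agree ha₁⟩
  obtain ⟨t₂, τ₂, hx₂, ht₂, p, hp, hq₂⟩ := forLoop_levels_exec hq₁
  rw [hp] at hq₂
  obtain ⟨t₃, τ₃, hx₃, ht₃, hyes, hno⟩ := forLoop_checkStmt_exec hq₂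
  refine ⟨_, _, Exec.seq hx₁ (Exec.seq hx₂ (Exec.seq (Exec.assign _ _ _)
    (Exec.seq (Exec.assign _ _ _) (Exec.seq hx₃ (Exec.assign _ _ _))))), ?_, ?_, ?_⟩
  · have hlen := length_levels_le (B := B) k
    have hlen' := Nat.mul_le_mul_right (checkStmt.time (n + m) + 8) hlen
    have hW : 1 ≤ (numButtons B ^ 2 + 1) ^ k := Nat.one_le_pow _ _ (Nat.succ_pos _)
    simp only [Expr.cost, searchTime]
    generalize (numButtons B ^ 2 + 1) ^ k = W at *
    generalize initStmt.time (n + m) = a at *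
    generalize processStmt.time (n + m) = b at *
    generalize checkStmt.time (n + m) = c at *
    have hkW : k + 1 ≤ (k + 1) * W := Nat.le_mul_of_pos_right _ hW
    have e₁ : k * (W * (b + 8) + 10 + 8) + 6 ≤ (k + 1) * W * (b + 32) := by
      nlinarith [Nat.zero_le (k * W * b), Nat.zero_le (W * b)]
    have e₂ : (k + 1) * W * (a + b + c + 60) = (k + 1) * W * a + (k + 1) * W * (b + 32) +
      (k + 1) * W * (c + 8) + (k + 1) * W * 20 := by ring
    have e₃ : a ≤ (k + 1) * W * a := Nat.le_mul_of_pos_left _ (by omega)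
    omega
  · intro hs
    simp [Expr.eval, hyes (solvable_iff_zero_mem_levels.1 hs)]
  · intro hs
    simp [Expr.eval, hno fun h => hs (solvable_iff_zero_mem_levels.2 h)]

end SearchProgram

/-! ### Running times -/

/-- The number of nodes of the search tree in dependence on `k` alone. The constant factor covers
`k ≤ 1`, where the exponent on the right vanishes. -/
theorem search_size_le (k : ℕ) :
    (((k + 1) * ((4 * 64 ^ k) ^ 2 + 1) ^ k : ℕ) : ℝ) ≤
      131074 * (2 : ℝ) ^ (16 * ((k : ℝ) ^ 2 * Real.logb 2 k)) := by
  rcases Nat.lt_or_ge k 2 with hk | hk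
  · interval_cases k <;> norm_num
  · have h₁ : (4 * 64 ^ k) ^ 2 + 1 ≤ 2 ^ (15 * k) := by
      have e : (4 * 64 ^ k) ^ 2 = 2 ^ (12 * k + 4) := by
        rw [show (64 : ℕ) = 2 ^ 6 by norm_num, show (4 : ℕ) = 2 ^ 2 by norm_num, ← pow_mul, ← pow_add,
          ← pow_mul]
        ring_nf
      calc (4 * 64 ^ k) ^ 2 + 1 ≤ 2 ^ (12 * k + 4) + 2 ^ (12 * k + 4) := by
            rw [e]; exact Nat.add_le_add_left Nat.one_le_two_pow _
        _ = 2 ^ (12 * k + 5) := by ring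
        _ ≤ 2 ^ (15 * k) := Nat.pow_le_pow_right (by omega) (by omega)
    have h₂ : (k + 1) * ((4 * 64 ^ k) ^ 2 + 1) ^ k ≤ 2 ^ (16 * k ^ 2) := by
      calc (k + 1) * ((4 * 64 ^ k) ^ 2 + 1) ^ k ≤ 2 ^ (k ^ 2) * (2 ^ (15 * k)) ^ k := by
            refine Nat.mul_le_mul ?_ (Nat.pow_le_pow_left h₁ k)
            calc k + 1 ≤ 2 ^ k := Nat.lt_two_pow_self
              _ ≤ 2 ^ (k ^ 2) := Nat.pow_le_pow_right (by omega) (by nlinarith)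
        _ = 2 ^ (16 * k ^ 2) := by rw [← pow_mul, ← pow_add]; ring_nf
    have hlog : 1 ≤ Real.logb 2 k := by
      rw [Real.le_logb_iff_rpow_le (by norm_num) (by positivity), Real.rpow_one]
      exact_mod_cast hk
    calc (((k + 1) * ((4 * 64 ^ k) ^ 2 + 1) ^ k : ℕ) : ℝ) ≤ ((2 ^ (16 * k ^ 2) : ℕ) : ℝ) := by
          exact_mod_cast h₂
      _ = (2 : ℝ) ^ ((16 * k ^ 2 : ℕ) : ℝ) := by rw [Real.rpow_natCast]; norm_num
      _ ≤ (2 : ℝ) ^ (16 * ((k : ℝ) ^ 2 * Real.logb 2 k)) := by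
          refine Real.rpow_le_rpow_of_exponent_le (by norm_num) ?_
          push_cast
          nlinarith [sq_nonneg (k : ℝ)]
      _ ≤ _ := le_mul_of_one_le_left (by positivity) (by norm_num)

/-- The size of the reduced instances. The constant factor covers `k = 1`, where the exponent on the
right vanishes. -/
theorem kernel_size_le (k : ℕ) :
    ((4 * 64 ^ k : ℕ) : ℝ) ≤ 256 * (2 : ℝ) ^ (6 * ((k : ℝ) * Real.logb 2 k)) := by
  rcases Nat.lt_or_ge k 2 with hk | hk
  · interval_cases k <;> norm_num
  · have hlog : 1 ≤ Real.logb 2 k := by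
      rw [Real.le_logb_iff_rpow_le (by norm_num) (by positivity), Real.rpow_one]
      exact_mod_cast hk
    have e : ((64 ^ k : ℕ) : ℝ) = (2 : ℝ) ^ ((6 * k : ℕ) : ℝ) := by
      rw [Real.rpow_natCast, pow_mul]; norm_num
    rw [Nat.cast_mul, e]
    refine mul_le_mul (by norm_num) (Real.rpow_le_rpow_of_exponent_le (by norm_num) ?_)
      (by positivity) (by norm_num)
    push_cast
    nlinarith [Nat.cast_nonneg (α := ℝ) k]

theorem shrinksInTime_reduceStmt {D C : ℕ} (hD : ∀ N, reduceStmt.time N ≤ D * (N + 1) ^ D)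
    (hC : D + 256 ≤ C) :
    ShrinksInTime reduceStmt.compile (fun n m => (C : ℝ) * ((n : ℝ) + (m : ℝ) + 1) ^ C)
      (fun k => (C : ℝ) * (2 : ℝ) ^ ((C : ℝ) * ((k : ℝ) * Real.logb 2 (k : ℝ)))) := by
  intro n m B k
  obtain ⟨t, τ, hx, ht, hτ⟩ := reduceStmt_exec (inputState_holds B k)
  have hCr : (256 : ℝ) ≤ C := by exact_mod_cast (show 256 ≤ C by omega)
  refine ⟨t, τ, hx, ?_, n, m, reduced k B, le_rfl, le_rfl, hτ, solvable_reduced, ?_⟩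
  · have : t ≤ C * (n + m + 1) ^ C := by
      refine (ht.trans (hD _)).trans (Nat.mul_le_mul (by omega) ?_)
      exact Nat.pow_le_pow_right (by omega) (by omega)
    show (t : ℝ) ≤ (C : ℝ) * ((n : ℝ) + (m : ℝ) + 1) ^ C
    exact_mod_cast this
  · have hlog : 0 ≤ (k : ℝ) * Real.logb 2 k := by
      rcases Nat.eq_zero_or_pos k with rfl | hk
      · simp
      · exact mul_nonneg (by positivity) (Real.logb_nonneg (by norm_num) (by exact_mod_cast hk))
    calc (numButtons (reduced k B) : ℝ) ≤ ((4 * 64 ^ k : ℕ) : ℝ) := by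
          exact_mod_cast numButtons_reduced_le k B
      _ ≤ 256 * (2 : ℝ) ^ (6 * ((k : ℝ) * Real.logb 2 k)) := kernel_size_le k
      _ ≤ _ := by
          refine mul_le_mul hCr (Real.rpow_le_rpow_of_exponent_le (by norm_num) ?_)
            (by positivity) (by positivity)
          exact mul_le_mul_of_nonneg_right (by linarith) hlog

theorem decidesInTime_search {D C : ℕ}
    (hD : ∀ N, reduceStmt.time N + searchTime N ≤ D * (N + 1) ^ D) (hC : 131074 * D + 16 ≤ C) :
    DecidesInTime (.seq reduceStmt.compile searchProgram) fun n m k =>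
      (C : ℝ) * (2 : ℝ) ^ ((C : ℝ) * ((k : ℝ) ^ 2 * Real.logb 2 (k : ℝ))) *
        ((n : ℝ) + (m : ℝ) + 1) ^ C := by
  intro n m B k
  obtain ⟨t₁, τ₁, hx₁, ht₁, h₁⟩ := reduceStmt_exec (inputState_holds B k)
  obtain ⟨t₂, τ₂, hx₂, ht₂, hyes, hno⟩ := searchProgram_exec h₁
  rw [solvable_reduced] at hyes hno
  refine ⟨_, τ₂, Exec.seq hx₁ hx₂, ?_, hyes, hno⟩
  have hsize := search_size_le k
  set W := (k + 1) * ((4 * 64 ^ k) ^ 2 + 1) ^ k with hW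
  have hW1 : 1 ≤ W := Nat.mul_pos (Nat.succ_pos _) (pow_pos (Nat.succ_pos _) _)
  have ht : t₁ + t₂ ≤ W * (D * (n + m + 1) ^ D) := by
    have hle : (k + 1) * (numButtons (reduced k B) ^ 2 + 1) ^ k ≤ W := by
      refine Nat.mul_le_mul_left _ (Nat.pow_le_pow_left ?_ _)
      exact Nat.add_le_add_right (Nat.pow_le_pow_left (numButtons_reduced_le k B) 2) 1
    calc t₁ + t₂ ≤ W * reduceStmt.time (n + m) + W * searchTime (n + m) := by
          refine Nat.add_le_add (ht₁.trans ?_) (ht₂.trans (Nat.mul_le_mul_right _ hle))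
          exact Nat.le_mul_of_pos_left _ hW1
      _ = W * (reduceStmt.time (n + m) + searchTime (n + m)) := by ring
      _ ≤ _ := Nat.mul_le_mul_left _ (hD _)
  have hlog : 0 ≤ (k : ℝ) ^ 2 * Real.logb 2 k := by
    rcases Nat.eq_zero_or_pos k with rfl | hk
    · simp
    · exact mul_nonneg (by positivity) (Real.logb_nonneg (by norm_num) (by exact_mod_cast hk))
  have hnm : (1 : ℝ) ≤ (n : ℝ) + m + 1 := by
    linarith [Nat.cast_nonneg (α := ℝ) n, Nat.cast_nonneg (α := ℝ) m]
  have hCr : (131074 : ℝ) * D + 16 ≤ C := by exact_mod_cast hC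
  have hDr : (0 : ℝ) ≤ D := Nat.cast_nonneg D
  calc ((t₁ + t₂ : ℕ) : ℝ) ≤ (W : ℝ) * (D * ((n : ℝ) + m + 1) ^ D) := by exact_mod_cast ht
    _ ≤ (131074 * (2 : ℝ) ^ (16 * ((k : ℝ) ^ 2 * Real.logb 2 k))) *
        (D * ((n : ℝ) + m + 1) ^ C) :=
        mul_le_mul hsize (mul_le_mul_of_nonneg_left (pow_le_pow_right₀ hnm (by omega)) hDr)
          (by positivity) (by positivity)
    _ = (131074 * D) * (2 : ℝ) ^ (16 * ((k : ℝ) ^ 2 * Real.logb 2 k)) *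
        ((n : ℝ) + m + 1) ^ C := by ring
    _ ≤ _ := by
        refine mul_le_mul_of_nonneg_right ?_ (by positivity)
        refine mul_le_mul (by linarith) (Real.rpow_le_rpow_of_exponent_le (by norm_num) ?_)
          (by positivity) (by positivity)
        exact mul_le_mul_of_nonneg_right (by linarith) hlog

end ButtonsScissors

theorem mainTheorem1 :
    (∃ (P : ButtonsScissors.Program) (C : ℕ),
      ButtonsScissors.DecidesInTime P fun n m k =>
        (C : ℝ) * (2 : ℝ) ^ ((C : ℝ) * ((k : ℝ) ^ 2 * Real.logb 2 (k : ℝ))) *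
          ((n : ℝ) + (m : ℝ) + 1) ^ C) ∧
    (∃ (Q : ButtonsScissors.Program) (C : ℕ),
      ButtonsScissors.ShrinksInTime Q
        (fun n m => (C : ℝ) * ((n : ℝ) + (m : ℝ) + 1) ^ C)
        (fun k => (C : ℝ) * (2 : ℝ) ^ ((C : ℝ) * ((k : ℝ) * Real.logb 2 (k : ℝ))))) := by
  open ButtonsScissors in
  have hs : PolyBounded searchTime :=
    ((initStmt.polyBounded_time.add processStmt.polyBounded_time).add
      checkStmt.polyBounded_time).add (.const 60)
  obtain ⟨D, hD⟩ := ButtonsScissors.reduceStmt.polyBounded_time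
  obtain ⟨E, hE⟩ := ButtonsScissors.reduceStmt.polyBounded_time.add hs
  exact ⟨⟨_, _, ButtonsScissors.decidesInTime_search hE le_rfl⟩,
    ⟨_, _, ButtonsScissors.shrinksInTime_reduceStmt hD le_rfl⟩⟩
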